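/- **Dimensional reduction.** Let $\Lambda$ be a finite set, let $\beta=(\beta_{ij})_{i,j\in\Lambda}$ be symmetric with $\beta_{ij}\ge 0$, and let $h=(h_i)_{i\in\Lambda}$ with $h_i\ge 0$. For integers $n,m\ge 0$ consider the Grassmann algebra with (anticommuting) generators $\xi_i^\ell,\eta_i^\ell$ ($i\in\Lambda$, $1\le \ell\le m$) over the smooth functions of $\phi=(\phi_i^\ell)_{i\in\Lambda,1\le\ell\le n}\in\mathbb R^{n\Lambda}$; its elements are called forms. Smooth functions of even forms are defined by Taylor expansion in the nilpotent part. Let $\partial_{\xi_i^\ell},\partial_{\eta_i^\ell}$ be the (left) fermionic derivatives, and put $$z_i=\Big(1+\sum_{\ell=1}^n(\phi_i^\ell)^2-2\sum_{\ell=1}^m\xi_i^\ell\eta_i^\ell\Big)^{1/2},\qquad u_i=(\phi_i,\xi_i,\eta_i,z_i),$$ $$u_i\cdot u_j=\sum_{\ell=1}^n\phi_i^\ell\phi_j^\ell+\sum_{\ell=1}^m(\eta_i^\ell\xi_j^\ell-\xi_i^\ell\eta_j^\ell)-z_iz_j ,$$ $$H_{\beta,h}=\tfrac14\sum_{i,j\in\Lambda}\beta_{ij}(u_i-u_j)\cdot(u_i-u_j)+\sum_{i\in\Lambda}h_i(z_i-1).$$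 The unnormalised expectation of a form $G$ in the $\mathbb H^{n|2m}$ model is $$[G]^{\mathbb H^{n|2m}}_{\beta,h}=\int_{\mathbb R^{n\Lambda}}\prod_{i\in\Lambda}\frac{d\phi_i^1\cdots d\phi_i^n}{(2\pi)^{n/2}}\;\prod_{i\in\Lambda}\big(\partial_{\eta_i^1}\partial_{\xi_i^1}\cdots\partial_{\eta_i^m}\partial_{\xi_i^m}\big)\Big(\prod_{i\in\Lambda}\frac1{z_i}\Big)G\,e^{-H_{\beta,h}}$$ (for $n=0$ there is no integral over $\phi$). Let $\tilde\Lambda=\Lambda\cup\{\delta\}$ with an extra point $\delta$, and let $(u_i\cdot u_j)_{i,j}$ denote the collection of even forms indexed by $i,j\in\tilde\Lambda$, with the convention $u_\delta\cdot u_i=u_i\cdot u_\delta=z_i$ for $i\in\Lambda$ and $u_\delta\cdot u_\delta=-1$. Let $F:\mathbb R^{\tilde\Lambda\times\tilde\Lambda}\to\mathbb R$ be smooth and such that the $\mathbb H^{2|4}$ integral of $F((u_i\cdot u_j)_{i,j})$ exists, in the sense that the form $$\prod_{i\in\Lambda}\partial_{\eta_i^2}\partial_{\xi_i^2}\Big(\prod_{i\in\Lambda}\frac1{z_i}\Big)F\big((u_i\cdot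 u_j)_{i,j}\big)e^{-H_{\beta,h}}$$ in the remaining odd variables $(\xi_i^1,\eta_i^1)_{i\in\Lambda}$ has coefficient functions that are Lebesgue integrable on $\mathbb R^{2\Lambda}$ (which holds in particular if all coefficient functions of $\big(\prod_i\frac1{z_i}\big)F((u_i\cdot u_j)_{i,j})\,e^{-H_{\beta,h}}$ are integrable). Then $$\big[F((u_i\cdot u_j)_{i,j})\big]^{\mathbb H^{0|2}}_{\beta,h}=\big[F((u_i\cdot u_j)_{i,j})\big]^{\mathbb H^{2|4}}_{\beta,h}.$$ -/

import Mathlib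

open MeasureTheory
open scoped ContDiff

namespace SuperHyperbolic

noncomputable section

/-! ### Grassmann algebras, fermionic derivatives, functions of even elements -/

/-- The real Grassmann (exterior) algebra with generators `ξ_k, η_k`, `k ∈ ι`.
The generator `ξ_k` is indexed by `Sum.inl k` and `η_k` by `Sum.inr k`. -/
abbrev Grassmann (ι : Type*) := ExteriorAlgebra ℝ ((ι ⊕ ι) →₀ ℝ)

section Grassmann

variable {ι : Type*}

/-- The generator `ξ_k`. -/
def xi (k : ι) : Grassmann ι := ExteriorAlgebra.ι ℝ (Finsupp.single (Sum.inl k) 1)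

/-- The generator `η_k`. -/
def eta (k : ι) : Grassmann ι := ExteriorAlgebra.ι ℝ (Finsupp.single (Sum.inr k) 1)

/-- The fermionic (left) derivative in the generator `g`: the odd derivation of the
Grassmann algebra that sends `g` to `1` and every other generator to `0`. -/
def fermDeriv (g : ι ⊕ ι) : Module.End ℝ (Grassmann ι) :=
  CliffordAlgebra.contractLeft (Finsupp.lapply g)

/-- The even operator `∂_{η_k} ∂_{ξ_k}`. -/
def pairDeriv (k : ι) : Module.End ℝ (Grassmann ι) :=
  fermDeriv (Sum.inr k) * fermDeriv (Sum.inl k)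

theorem fermDeriv_anticomm (g g' : ι ⊕ ι) (x : Grassmann ι) :
    fermDeriv g (fermDeriv g' x) = -fermDeriv g' (fermDeriv g x) :=
  CliffordAlgebra.contractLeft_comm _ _ _

theorem pairDeriv_commute (k l : ι) : Commute (pairDeriv k) (pairDeriv l) := by
  refine LinearMap.ext fun x => ?_
  simp only [pairDeriv, Module.End.mul_apply]
  rw [fermDeriv_anticomm (Sum.inl k) (Sum.inr l), fermDeriv_anticomm (Sum.inl k) (Sum.inl l),
    map_neg, map_neg, map_neg, neg_neg, fermDeriv_anticomm (Sum.inr k) (Sum.inr l),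
    fermDeriv_anticomm (Sum.inr k) (Sum.inl l), map_neg, neg_neg]

/-- The Berezin integration `∏_{k ∈ S} ∂_{η_k} ∂_{ξ_k}` (the factors commute). -/
def berezin (S : Finset ι) : Module.End ℝ (Grassmann ι) :=
  S.noncommProd pairDeriv (fun k _ l _ _ => pairDeriv_commute k l)

/-- The degree-`0` part of an element of the Grassmann algebra. -/
def body (a : Grassmann ι) : ℝ := ExteriorAlgebra.algebraMapInv a

/-- The part of positive degree (the nilpotent part) of an element. -/
def soul (a : Grassmann ι) : Grassmann ι := a - algebraMap ℝ (Grassmann ι) (body a)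

theorem ι_anticomm (x y : (ι ⊕ ι) →₀ ℝ) :
    ExteriorAlgebra.ι ℝ x * ExteriorAlgebra.ι ℝ y =
      -(ExteriorAlgebra.ι ℝ y * ExteriorAlgebra.ι ℝ x) :=
  eq_neg_of_add_eq_zero_left (ExteriorAlgebra.ι_add_mul_swap x y)

theorem commute_xi_mul_eta (k l : ι) :
    Commute (xi k * eta k) (xi l * eta l) := by
  have key : ∀ v : (ι ⊕ ι) →₀ ℝ, Commute (xi k * eta k) (ExteriorAlgebra.ι ℝ v) := by
    intro v
    unfold Commute SemiconjBy xi eta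
    rw [mul_assoc, ι_anticomm _ v, mul_neg, ← mul_assoc, ι_anticomm _ v, neg_mul, neg_neg,
      mul_assoc]
  exact (key _).mul_right (key _)

variable [Fintype ι]

/-- `f a` for a function `f` of one real variable, smooth near `body a`, and an even `a`: the
Taylor expansion of `f` at the body of `a`. The terms of order larger than `2 |ι|`, the number
of generators, vanish. -/
def evalOne (f : ℝ → ℝ) (a : Grassmann ι) : Grassmann ι :=
  ∑ p ∈ Finset.range (2 * Fintype.card ι + 1),
    ((p.factorial : ℝ)⁻¹ * iteratedDeriv p f (body a)) • soul a ^ p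

theorem commute_evalOne (f g : ℝ → ℝ) {a b : Grassmann ι}
    (hab : Commute a b) : Commute (evalOne f a) (evalOne g b) := by
  refine Commute.sum_left _ _ _ fun p _ => Commute.sum_right _ _ _ fun q _ => ?_
  refine Commute.smul_left (Commute.smul_right (Commute.pow_pow ?_ p q) _) _
  exact (hab.sub_left (Algebra.commutes _ _)).sub_right
    ((Algebra.commutes _ _).symm)

/-- `F ((a_k)_k)` for a smooth function `F` of finitely many real variables and a tuple of even
elements: the Taylor expansion of `F` at `(body a_k)_k`,
`∑_p (1 / p!) ∑_{k_1, …, k_p} (∂_{k_1} ⋯ ∂_{k_p} F)(body a) soul a_{k_1} ⋯ soul a_{k_p}`.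
The terms of order larger than `2 |ι|`, the number of generators, vanish. -/
def evalMany {K : Type*} [Fintype K] (F : (K → ℝ) → ℝ) (a : K → Grassmann ι) : Grassmann ι :=
  open Classical in
  ∑ p ∈ Finset.range (2 * Fintype.card ι + 1), ∑ k : Fin p → K,
    ((p.factorial : ℝ)⁻¹ *
      iteratedFDeriv ℝ p F (fun l => body (a l)) (fun r => Pi.single (k r) 1)) •
      (List.ofFn fun r => soul (a (k r))).prod

end Grassmann

/-! ### The spins of the `ℍ^{n|2m}` model -/

/-- Vectors `u = (φ, ξ, η, z)` with `n` even components `φ`, with `m` pairs of odd components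
`ξ, η`, and with an even component `z`. -/
structure SuperVec (n m : ℕ) (A : Type*) where
  phi : Fin n → A
  xi : Fin m → A
  eta : Fin m → A
  z : A

instance {n m : ℕ} {A : Type*} [Sub A] : Sub (SuperVec n m A) :=
  ⟨fun u v => ⟨u.phi - v.phi, u.xi - v.xi, u.eta - v.eta, u.z - v.z⟩⟩

/-- The inner product `u ⬝ v = ∑ φ φ' + ∑ (η ξ' - ξ η') - z z'`. -/
def SuperVec.dot {n m : ℕ} {A : Type*} [Ring A] (u v : SuperVec n m A) : A :=
  ∑ l, u.phi l * v.phi l + ∑ l, (u.eta l * v.xi l - u.xi l * v.eta l) - u.z * v.z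

section Model

variable {Λ : Type*} {n m : ℕ}

/-- Forms (superfunctions) on `(ℝ^n)^Λ`: functions of the even coordinates `φ` with values in
the Grassmann algebra generated by `ξ_i^l, η_i^l`, for `i ∈ Λ` and `l ∈ {1, …, m}`. -/
abbrev Form (Λ : Type*) (n m : ℕ) := (Λ → Fin n → ℝ) → Grassmann (Λ × Fin m)

/-- `z_i ^ 2 = 1 + ∑_l (φ_i^l)^2 - 2 ∑_l ξ_i^l η_i^l`. -/
def zSq (i : Λ) : Form Λ n m := fun φ =>
  algebraMap ℝ _ (1 + ∑ l, φ i l ^ 2) + ∑ l, (-2 : ℝ) • (xi (i, l) * eta (i, l))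

theorem commute_zSq (φ : Λ → Fin n → ℝ) (i j : Λ) :
    Commute (zSq (m := m) i φ) (zSq j φ) := by
  unfold zSq
  refine Commute.add_left (Algebra.commutes _ _) (Commute.add_right
    (Algebra.commutes _ _).symm ?_)
  refine Commute.sum_left _ _ _ fun p _ => Commute.sum_right _ _ _ fun q _ => ?_
  exact Commute.smul_left (Commute.smul_right (commute_xi_mul_eta _ _) _) _

variable [Fintype Λ]

/-- The even form `z_i`, the square root of `zSq i`. -/
def zForm (i : Λ) : Form Λ n m := fun φ => evalOne Real.sqrt (zSq i φ)

/-- The spin `u_i = (φ_i, ξ_i, η_i, z_i)`, at the point `φ`. -/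
def spin (φ : Λ → Fin n → ℝ) (i : Λ) : SuperVec n m (Grassmann (Λ × Fin m)) where
  phi l := algebraMap ℝ _ (φ i l)
  xi l := xi (i, l)
  eta l := eta (i, l)
  z := zForm i φ

/-- The collection `(u_i ⬝ u_j)_{i,j}` of forms indexed by `i, j ∈ Λ ∪ {δ}`, where `δ` is `none`,
with the convention `u_δ ⬝ u_i = u_i ⬝ u_δ = z_i` and `u_δ ⬝ u_δ = -1`. -/
def gram (φ : Λ → Fin n → ℝ) : Option Λ × Option Λ → Grassmann (Λ × Fin m)
  | (none, none) => -1
  | (none, some i) => zForm i φ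
  | (some i, none) => zForm i φ
  | (some i, some j) => (spin φ i).dot (spin φ j)

/-- The form `F ((u_i ⬝ u_j)_{i,j})`. -/
def observable (n m : ℕ) (F : (Option Λ × Option Λ → ℝ) → ℝ) : Form Λ n m := fun φ =>
  evalMany F (gram φ)

/-- The action
`H_{β,h} = (1/4) ∑_{i,j} β_{ij} (u_i - u_j)^2 + ∑_i h_i (z_i - 1)`, where `v^2 = v ⬝ v`. -/
def action (β : Λ → Λ → ℝ) (h : Λ → ℝ) : Form Λ n m := fun φ =>
  (1 / 4 : ℝ) • ∑ i, ∑ j, β i j • (spin φ i - spin φ j).dot (spin φ i - spin φ j)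
    + ∑ i, h i • (zForm i φ - 1)

/-! ### The superintegral -/

/-- The form `∏_{i ∈ Λ} 1 / z_i` (the factors commute). -/
def prodInvZ : Form Λ n m := fun φ =>
  Finset.univ.noncommProd (fun i => evalOne (fun t => t⁻¹) (zForm i φ))
    (fun i _ j _ _ => commute_evalOne _ _ (commute_evalOne _ _ (commute_zSq φ i j)))

/-- The superintegral of a form `G`,
`∫ ∏_i (dφ_i^1 ⋯ dφ_i^n / (2π)^{n/2}) ∂_{η_i^1} ∂_{ξ_i^1} ⋯ ∂_{η_i^m} ∂_{ξ_i^m} (∏_i 1 / z_i) G`.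
For `n = 0` the integral is over the one-point space with unit mass. -/
def superIntegral (G : Form Λ n m) : ℝ :=
  (∏ _i : Λ, ((2 * Real.pi) ^ ((n : ℝ) / 2))⁻¹) *
    ∫ φ : Λ → Fin n → ℝ, body (berezin Finset.univ (prodInvZ φ * G φ))

/-- `G e^{-H_{β,h}}`. -/
def weighted (β : Λ → Λ → ℝ) (h : Λ → ℝ) (G : Form Λ n m) : Form Λ n m := fun φ =>
  G φ * evalOne Real.exp (-action β h φ)

/-- The unnormalised expectation `[G]_{β,h}` of the `ℍ^{n|2m}` model. -/
def expectation (β : Λ → Λ → ℝ) (h : Λ → ℝ) (G : Form Λ n m) : ℝ :=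
  superIntegral (weighted β h G)

/-- The superintegral of `G` exists, with the odd variables `ξ^l, η^l` of one index `l` integrated
out first: the form `∏_i ∂_{η_i^l} ∂_{ξ_i^l} (∏_i 1 / z_i) G` in the remaining variables has
integrable coefficient functions. (Since the Grassmann algebra is finite dimensional, this says
that all its linear functionals are integrable along the form.)
This is implied by integrability of all the coefficient functions of `(∏_i 1 / z_i) G`, and it
contains integrability of the top coefficient, which is what `superIntegral` integrates. -/
def SuperIntegrable (l : Fin m) (G : Form Λ n m) : Prop :=
  ∀ c : Module.Dual ℝ (Grassmann (Λ × Fin m)),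
    Integrable fun φ : Λ → Fin n → ℝ =>
      c (berezin (Finset.univ ×ˢ {l}) (prodInvZ φ * G φ))

/-- For `n = 0` the superintegral is the purely fermionic integral
`∏_i ∂_{η_i} ∂_{ξ_i} (∏_i 1 / z_i) G`. -/
theorem superIntegral_zero (G : Form Λ 0 m) :
    superIntegral G = body (berezin Finset.univ (prodInvZ (fun _ => Fin.elim0) *
      G (fun _ => Fin.elim0))) := by
  unfold superIntegral
  have h0 : (volume : Measure (Fin 0 → ℝ)) Set.univ = 1 := by
    rw [← Set.pi_univ Set.univ, volume_pi, Measure.pi_pi]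
    simp
  have h1 : (volume : Measure (Λ → Fin 0 → ℝ)) Set.univ = 1 := by
    rw [← Set.pi_univ Set.univ, volume_pi, Measure.pi_pi]
    simp [h0]
  rw [integral_unique, Measure.real, h1, ENNReal.toReal_one, one_smul]
  simp only [CharP.cast_eq_zero, zero_div, Real.rpow_zero, inv_one, Finset.prod_const_one, one_mul]
  exact congrArg (fun φ => body (berezin Finset.univ (prodInvZ φ * G φ))) (Subsingleton.elim _ _)

end Model

end

end SuperHyperbolic

namespace SuperHyperbolic

noncomputable section

/-! ### The degree-`0` part as an algebra homomorphism. -/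

section Algebra

variable {ι : Type*}

/-! The proof is supersymmetric localization in `φ` and the first pair of odd variables. The odd
operator `Q` (`susy`) sends `φ_i^1` to `ξ_i`, `φ_i^2` to `η_i`, `ξ_i` to `φ_i^2` and `η_i` to
`-φ_i^1`, where `ξ_i, η_i` is the first pair, and it ignores the second pair. It annihilates `φ_i ⬝
φ_j + ∑ (η_i ξ_j - ξ_i η_j)` (`isSusy_flatDot`). A smooth function of even `Q`-closed forms is again
`Q`-closed (`IsSusy.evalOne`, `IsSusy.evalMany`), so `z_i`, all `u_i ⬝ u_j`, and the whole integrand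
are `Q`-closed. Berezin integration over the second pair commutes with `Q` and leaves a `Q`-closed
form `f` with integrable coefficients.

For such `f`, `integral_berezinBody_eq` says that the integral over `φ` and the first pair is
`(2π)^|Λ|` times the degree-`0` part of `f` at `φ = 0`. Its proof multiplies `f` by cutoffs
`χ(Qλ_i)`, where `λ_i = φ_i^2 ξ_i - φ_i^1 η_i` (`pot`) and `Qλ_i = |φ_i|^2 - 2 ξ_i η_i`. Since `χ(x)
- χ'(x) = x θ(x)`, exchanging cutoffs at one site changes the integrand by `Q(λ_i g)` with `g`
closed and compactly supported. The integral of a `Q`-exact form of compact support vanishes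
(`integral_berezinBody_susy`), so the integral does not depend on the cutoffs. Wide cutoffs recover
the integral of `f` (`tendsto_integral_cut_small`), and narrow ones concentrate it at the origin
(`tendsto_integral_cut_large`).

Finally, setting `φ = 0` and the first pair to zero is an algebra homomorphism that commutes with
functions of even elements, and it turns the `ℍ^{2|4}` integrand into the `ℍ^{0|2}` one. The powers
of `2π` cancel against the normalisation. -/

theorem body_eq (a : Grassmann ι) : body a = ExteriorAlgebra.algebraMapInv a := rfl

@[simp] theorem body_zero : body (0 : Grassmann ι) = 0 := map_zero _
@[simp] theorem body_one : body (1 : Grassmann ι) = 1 := map_one _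
@[simp] theorem body_add (a b : Grassmann ι) : body (a + b) = body a + body b := map_add _ _ _
@[simp] theorem body_sub (a b : Grassmann ι) : body (a - b) = body a - body b := map_sub _ _ _
@[simp] theorem body_mul (a b : Grassmann ι) : body (a * b) = body a * body b := map_mul _ _ _
@[simp] theorem body_smul (r : ℝ) (a : Grassmann ι) : body (r • a) = r * body a := map_smul _ _ _
@[simp] theorem body_pow (a : Grassmann ι) (p : ℕ) : body (a ^ p) = body a ^ p := map_pow _ _ _
@[simp] theorem body_algebraMap (r : ℝ) : body (algebraMap ℝ (Grassmann ι) r) = r :=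
  AlgHom.commutes _ _
@[simp] theorem body_ι (v : (ι ⊕ ι) →₀ ℝ) : body (ExteriorAlgebra.ι ℝ v) = 0 := by
  rw [body_eq, ExteriorAlgebra.algebraMapInv, ExteriorAlgebra.lift_ι_apply]; rfl
@[simp] theorem body_xi (k : ι) : body (xi k) = 0 := body_ι _
@[simp] theorem body_eta (k : ι) : body (eta k) = 0 := body_ι _
@[simp] theorem body_sum {α : Type*} (s : Finset α) (f : α → Grassmann ι) :
    body (∑ i ∈ s, f i) = ∑ i ∈ s, body (f i) := map_sum _ _ _

@[simp] theorem body_soul (a : Grassmann ι) : body (soul a) = 0 := by simp [soul]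

theorem algebraMap_body_add_soul (a : Grassmann ι) :
    algebraMap ℝ (Grassmann ι) (body a) + soul a = a := by simp [soul]

/-! ### Nilpotency of the augmentation ideal -/

/-- A scalar moves past the generator, and a product of positive degree already begins with one.
Signs never have to be tracked. -/
theorem mul_ι_mem (a : Grassmann ι) (v : (ι ⊕ ι) →₀ ℝ) :
    a * ExteriorAlgebra.ι ℝ v ∈
      LinearMap.range (ExteriorAlgebra.ι ℝ : ((ι ⊕ ι) →₀ ℝ) →ₗ[ℝ] Grassmann ι) * ⊤ := by
  induction a using ExteriorAlgebra.induction generalizing v with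
  | algebraMap r =>
    rw [Algebra.commutes]
    exact Submodule.mul_mem_mul ⟨v, rfl⟩ trivial
  | ι w => exact Submodule.mul_mem_mul ⟨w, rfl⟩ trivial
  | mul a b ha hb =>
    rw [mul_assoc]
    refine Submodule.mul_induction_on (hb v) ?_ ?_
    · rintro _ ⟨w, rfl⟩ c -
      rw [← mul_assoc]
      refine Submodule.mul_induction_on (ha w) ?_ ?_
      · rintro _ ⟨u, rfl⟩ d -
        rw [mul_assoc]
        exact Submodule.mul_mem_mul ⟨u, rfl⟩ trivial
      · intro x y hx hy
        rw [add_mul]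
        exact add_mem hx hy
    · intro x y hx hy
      rw [mul_add]
      exact add_mem hx hy
  | add a b ha hb =>
    rw [add_mul]
    exact add_mem (ha v) (hb v)

theorem top_mul_range_le :
    ⊤ * LinearMap.range (ExteriorAlgebra.ι ℝ : ((ι ⊕ ι) →₀ ℝ) →ₗ[ℝ] Grassmann ι) ≤
      LinearMap.range (ExteriorAlgebra.ι ℝ : ((ι ⊕ ι) →₀ ℝ) →ₗ[ℝ] Grassmann ι) * ⊤ := by
  rw [Submodule.mul_le]
  rintro a - _ ⟨v, rfl⟩
  exact mul_ι_mem a v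

theorem soul_mem (a : Grassmann ι) :
    soul a ∈ LinearMap.range (ExteriorAlgebra.ι ℝ : ((ι ⊕ ι) →₀ ℝ) →ₗ[ℝ] Grassmann ι) * ⊤ := by
  induction a using ExteriorAlgebra.induction with
  | algebraMap r => simp [soul]
  | ι w =>
    simpa [soul] using Submodule.mul_mem_mul
      (M := LinearMap.range (ExteriorAlgebra.ι ℝ : ((ι ⊕ ι) →₀ ℝ) →ₗ[ℝ] Grassmann ι))
      (N := ⊤) ⟨w, rfl⟩ (Submodule.mem_top (x := (1 : Grassmann ι)))
  | mul a b ha hb =>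
    have : soul (a * b) = soul a * b + body a • soul b := by
      simp only [soul, body_mul, map_mul, Algebra.smul_def, sub_mul, mul_sub]
      abel
    rw [this]
    refine add_mem ?_ (Submodule.smul_mem _ _ hb)
    refine Submodule.mul_induction_on ha ?_ ?_
    · rintro x hx c -
      rw [mul_assoc]
      exact Submodule.mul_mem_mul hx trivial
    · intro x y hx hy
      rw [add_mul]
      exact add_mem hx hy
  | add a b ha hb =>
    have : soul (a + b) = soul a + soul b := by simp only [soul, body_add, map_add]; abel
    rw [this]
    exact add_mem ha hb

theorem list_prod_mem_pow (l : List (Grassmann ι)) (hl : ∀ a ∈ l, body a = 0) :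
    l.prod ∈
      LinearMap.range (ExteriorAlgebra.ι ℝ : ((ι ⊕ ι) →₀ ℝ) →ₗ[ℝ] Grassmann ι) ^ l.length * ⊤ := by
  induction l with
  | nil => simp
  | cons a l ih =>
    rw [List.prod_cons, List.length_cons, pow_succ]
    have ha : a ∈ LinearMap.range
        (ExteriorAlgebra.ι ℝ : ((ι ⊕ ι) →₀ ℝ) →ₗ[ℝ] Grassmann ι) * ⊤ := by
      have h := soul_mem a
      rwa [soul, hl a (by simp), map_zero, sub_zero] at h
    have hl' := ih fun b hb => hl b (by simp [hb])
    -- Arbitrary factors standing between generators are pushed to the right end, one power at a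
    -- time.
    have key : ∀ n : ℕ, ⊤ * LinearMap.range
        (ExteriorAlgebra.ι ℝ : ((ι ⊕ ι) →₀ ℝ) →ₗ[ℝ] Grassmann ι) ^ n ≤
        LinearMap.range
        (ExteriorAlgebra.ι ℝ : ((ι ⊕ ι) →₀ ℝ) →ₗ[ℝ] Grassmann ι) ^ n * ⊤ := by
      intro n
      induction n with
      | zero => simp
      | succ n ih =>
        rw [pow_succ, ← mul_assoc]
        refine (mul_le_mul_left ih _).trans ?_
        rw [mul_assoc, mul_assoc]
        exact mul_le_mul_right top_mul_range_le _
    have h1 := Submodule.mul_mem_mul ha hl'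
    refine Set.mem_of_mem_of_subset h1 (SetLike.coe_subset_coe.2 ?_)
    rw [← pow_succ, pow_succ', mul_assoc, mul_assoc, ← mul_assoc ⊤ _ ⊤]
    refine mul_le_mul_right ((mul_le_mul_left (key _) _).trans ?_) _
    rw [mul_assoc]
    exact mul_le_mul_right le_top _

/-- A product of `p` elements without degree-`0` part lies in the ideal generated by the `p`-th
exterior power, which is zero once `p` exceeds the number `2 |ι|` of generators. -/
theorem list_prod_eq_zero [Fintype ι] (l : List (Grassmann ι)) (hl : ∀ a ∈ l, body a = 0)
    (hlen : 2 * Fintype.card ι < l.length) : l.prod = 0 := by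
  have h := list_prod_mem_pow l hl
  have h0 : ⋀[ℝ]^l.length ((ι ⊕ ι) →₀ ℝ) = ⊥ := by
    apply Submodule.finrank_eq_zero.1
    rw [exteriorPower.finrank_eq, Nat.choose_eq_zero_iff]
    simp
    omega
  change l.prod ∈ (⋀[ℝ]^l.length ((ι ⊕ ι) →₀ ℝ)) * ⊤ at h
  rw [h0, Submodule.bot_mul] at h
  simpa using h

instance finite_grassmann [Finite ι] : Module.Finite ℝ (Grassmann ι) := by
  classical
  let : LinearOrder (ι ⊕ ι) := linearOrderOfSTO (WellOrderingRel (α := ι ⊕ ι))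
  exact Module.Finite.of_basis (Module.Basis.ExteriorAlgebra (Finsupp.basisSingleOne (R := ℝ)))

/-! ### The subalgebra of even elements -/

theorem fermDeriv_ι_mul (g : ι ⊕ ι) (v : (ι ⊕ ι) →₀ ℝ) (x : Grassmann ι) :
    fermDeriv g (ExteriorAlgebra.ι ℝ v * x) =
      v g • x - ExteriorAlgebra.ι ℝ v * fermDeriv g x :=
  CliffordAlgebra.contractLeft_ι_mul _ _ _

@[simp] theorem fermDeriv_fermDeriv (g : ι ⊕ ι) (x : Grassmann ι) :
    fermDeriv g (fermDeriv g x) = 0 := CliffordAlgebra.contractLeft_contractLeft _ _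

@[simp] theorem fermDeriv_algebraMap (g : ι ⊕ ι) (r : ℝ) :
    fermDeriv g (algebraMap ℝ (Grassmann ι) r) = 0 := CliffordAlgebra.contractLeft_algebraMap _ _ _

/-- A subalgebra of elements that commute with all elements and are differentiated without sign
by the fermionic derivatives. It contains all elements of even degree. -/
def evenPart (ι : Type*) : Subalgebra ℝ (Grassmann ι) where
  carrier := {a | (∀ b, a * b = b * a) ∧
    ∀ g b, fermDeriv g (a * b) = fermDeriv g a * b + a * fermDeriv g b}
  mul_mem' := by
    rintro a b ⟨ha, ha'⟩ ⟨hb, hb'⟩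
    refine ⟨fun c => by rw [mul_assoc, hb c, ← mul_assoc, ha, mul_assoc], fun g c => ?_⟩
    rw [mul_assoc, ha', hb', ha']
    simp only [mul_add, add_mul, mul_assoc, add_assoc]
  add_mem' := by
    rintro a b ⟨ha, ha'⟩ ⟨hb, hb'⟩
    refine ⟨fun c => by rw [add_mul, mul_add, ha, hb], fun g c => ?_⟩
    rw [add_mul, map_add, ha', hb', map_add, add_mul, add_mul]
    abel
  algebraMap_mem' r := by
    refine ⟨fun b => Algebra.commutes _ _, fun g b => ?_⟩
    rw [fermDeriv_algebraMap, zero_mul, zero_add, ← Algebra.smul_def, map_smul, Algebra.smul_def]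

theorem mul_comm_of_mem_evenPart {a : Grassmann ι} (ha : a ∈ evenPart ι) (b : Grassmann ι) :
    a * b = b * a := ha.1 b

theorem fermDeriv_mul_of_mem_evenPart {a : Grassmann ι} (ha : a ∈ evenPart ι) (g : ι ⊕ ι)
    (b : Grassmann ι) : fermDeriv g (a * b) = fermDeriv g a * b + a * fermDeriv g b := ha.2 g b

/-- Commutativity makes unordered products `∏` of even elements available. -/
instance : CommRing (evenPart ι) :=
  { (inferInstance : Ring (evenPart ι)) with
    mul_comm := fun a b => Subtype.ext (a.2.1 b) }

theorem ι_mul_ι_mem_evenPart (v w : (ι ⊕ ι) →₀ ℝ) :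
    ExteriorAlgebra.ι ℝ v * ExteriorAlgebra.ι ℝ w ∈ evenPart ι := by
  refine ⟨fun b => ?_, fun g b => ?_⟩
  · induction b using ExteriorAlgebra.induction with
    | algebraMap r => exact (Algebra.commutes _ _).symm
    | ι u =>
      rw [mul_assoc, ι_anticomm w u, mul_neg, ← mul_assoc, ι_anticomm v u, neg_mul, neg_neg,
        mul_assoc]
    | mul a b ha hb => rw [← mul_assoc, ha, mul_assoc, hb, mul_assoc]
    | add a b ha hb => rw [mul_add, add_mul, ha, hb]
  · rw [mul_assoc, fermDeriv_ι_mul, fermDeriv_ι_mul, fermDeriv_ι_mul]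
    have : fermDeriv g (ExteriorAlgebra.ι ℝ w) = algebraMap ℝ _ (w g) :=
      CliffordAlgebra.contractLeft_ι _ _ _
    rw [this, ← Algebra.commutes, ← Algebra.smul_def]
    simp only [sub_mul, mul_sub, smul_mul_assoc, mul_smul_comm, mul_assoc]
    abel

theorem xi_mul_eta_mem_evenPart (k l : ι) : xi k * eta l ∈ evenPart ι := ι_mul_ι_mem_evenPart _ _
theorem eta_mul_xi_mem_evenPart (k l : ι) : eta k * xi l ∈ evenPart ι := ι_mul_ι_mem_evenPart _ _

theorem soul_mem_evenPart {a : Grassmann ι} (ha : a ∈ evenPart ι) : soul a ∈ evenPart ι :=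
  sub_mem ha (Subalgebra.algebraMap_mem _ _)

theorem evalOne_mem_evenPart [Fintype ι] (f : ℝ → ℝ) {a : Grassmann ι} (ha : a ∈ evenPart ι) :
    evalOne f a ∈ evenPart ι :=
  sum_mem fun _ _ => Subalgebra.smul_mem _ (pow_mem (soul_mem_evenPart ha) _) _

theorem evalMany_mem_evenPart [Fintype ι] {K : Type*} [Fintype K] (F : (K → ℝ) → ℝ)
    {a : K → Grassmann ι} (ha : ∀ k, a k ∈ evenPart ι) : evalMany F a ∈ evenPart ι := by
  refine sum_mem fun p _ => sum_mem fun k _ => Subalgebra.smul_mem _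
    (Subalgebra.list_prod_mem _ ?_) _
  intro x hx
  obtain ⟨r, rfl⟩ := List.mem_ofFn.1 hx
  exact soul_mem_evenPart (ha _)

/-! ### Taylor expansions -/

theorem soul_pow_eq_zero [Fintype ι] (a : Grassmann ι) {p : ℕ} (hp : 2 * Fintype.card ι < p) :
    soul a ^ p = 0 := by
  rw [← List.prod_replicate]
  refine list_prod_eq_zero _ (fun b hb => ?_) (by simpa using hp)
  rw [List.eq_of_mem_replicate hb, body_soul]

/-- Longer truncations agree because the extra powers of the soul vanish. This freedom is needed to
compare algebras with different numbers of generators and to let the telescoping sums below end in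
zero. -/
theorem evalOne_eq_sum [Fintype ι] (f : ℝ → ℝ) (a : Grassmann ι) {N : ℕ}
    (hN : 2 * Fintype.card ι < N) :
    evalOne f a = ∑ p ∈ Finset.range N,
      ((p.factorial : ℝ)⁻¹ * iteratedDeriv p f (body a)) • soul a ^ p := by
  refine Finset.sum_subset (Finset.range_mono hN) fun p _ hp => ?_
  rw [soul_pow_eq_zero a (by simpa using hp), smul_zero]

theorem evalMany_eq_sum [Fintype ι] {K : Type*} [Fintype K] [DecidableEq K] (F : (K → ℝ) → ℝ)
    (a : K → Grassmann ι) {N : ℕ} (hN : 2 * Fintype.card ι < N) :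
    evalMany F a = ∑ p ∈ Finset.range N, ∑ k : Fin p → K,
      ((p.factorial : ℝ)⁻¹ *
        iteratedFDeriv ℝ p F (fun l => body (a l)) (fun r => Pi.single (k r) 1)) •
        (List.ofFn fun r => soul (a (k r))).prod := by
  have : evalMany F a = ∑ p ∈ Finset.range (2 * Fintype.card ι + 1), ∑ k : Fin p → K,
      ((p.factorial : ℝ)⁻¹ *
        iteratedFDeriv ℝ p F (fun l => body (a l)) (fun r => Pi.single (k r) 1)) •
        (List.ofFn fun r => soul (a (k r))).prod := by
    unfold evalMany
    congr!
  rw [this]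
  refine Finset.sum_subset (Finset.range_mono hN) fun p _ hp => ?_
  refine Finset.sum_eq_zero fun k _ => ?_
  rw [list_prod_eq_zero, smul_zero]
  · intro b hb
    obtain ⟨r, rfl⟩ := List.mem_ofFn.1 hb
    exact body_soul _
  · simpa using hp

theorem body_evalOne [Fintype ι] (f : ℝ → ℝ) (a : Grassmann ι) :
    body (evalOne f a) = f (body a) := by
  unfold evalOne
  rw [body_sum, Finset.sum_range_succ', Finset.sum_eq_zero]
  · simp
  · intro p _
    simp

theorem map_soul {κ : Type*} (θ : Grassmann ι →ₐ[ℝ] Grassmann κ)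
    (hθ : ∀ a, body (θ a) = body a) (a : Grassmann ι) : θ (soul a) = soul (θ a) := by
  simp [soul, hθ]

/-- A homomorphism of Grassmann algebras that preserves the degree-`0` part commutes with
functions of even elements. -/
theorem map_evalOne [Fintype ι] {κ : Type*} [Fintype κ] (θ : Grassmann ι →ₐ[ℝ] Grassmann κ)
    (hθ : ∀ a, body (θ a) = body a) (f : ℝ → ℝ) (a : Grassmann ι) :
    θ (evalOne f a) = evalOne f (θ a) := by
  rw [evalOne_eq_sum f a (N := 2 * Fintype.card ι + 2 * Fintype.card κ + 1) (by omega),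
    evalOne_eq_sum f (θ a) (N := 2 * Fintype.card ι + 2 * Fintype.card κ + 1) (by omega), map_sum]
  simp only [map_smul, map_pow, map_soul θ hθ, hθ]

theorem map_evalMany [Fintype ι] {κ : Type*} [Fintype κ] (θ : Grassmann ι →ₐ[ℝ] Grassmann κ)
    (hθ : ∀ a, body (θ a) = body a) {K : Type*} [Fintype K] (F : (K → ℝ) → ℝ)
    (a : K → Grassmann ι) : θ (evalMany F a) = evalMany F (fun k => θ (a k)) := by
  classical
  rw [evalMany_eq_sum F a (N := 2 * Fintype.card ι + 2 * Fintype.card κ + 1) (by omega),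
    evalMany_eq_sum F _ (N := 2 * Fintype.card ι + 2 * Fintype.card κ + 1) (by omega), map_sum]
  simp only [map_sum, map_smul, map_list_prod, List.map_ofFn, Function.comp_def, map_soul θ hθ, hθ]

/-! ### Berezin integration -/

theorem pairDeriv_ι_mul (k : ι) (v : (ι ⊕ ι) →₀ ℝ) (hl : v (Sum.inl k) = 0)
    (hr : v (Sum.inr k) = 0) (x : Grassmann ι) :
    pairDeriv k (ExteriorAlgebra.ι ℝ v * x) = ExteriorAlgebra.ι ℝ v * pairDeriv k x := by
  simp [pairDeriv, fermDeriv_ι_mul, hl, hr]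

theorem pairDeriv_fermDeriv_comm (k : ι) (g : ι ⊕ ι) (x : Grassmann ι) :
    pairDeriv k (fermDeriv g x) = fermDeriv g (pairDeriv k x) := by
  simp only [pairDeriv, Module.End.mul_apply]
  rw [fermDeriv_anticomm (Sum.inl k) g, map_neg, fermDeriv_anticomm (Sum.inr k) g, neg_neg]

theorem pairDeriv_fermDeriv_self (k : ι) (g : ι ⊕ ι) (hg : g = Sum.inl k ∨ g = Sum.inr k)
    (x : Grassmann ι) : pairDeriv k (fermDeriv g x) = 0 := by
  rcases hg with rfl | rfl
  · simp [pairDeriv]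
  · simp only [pairDeriv, Module.End.mul_apply]
    rw [fermDeriv_anticomm (Sum.inl k), map_neg, fermDeriv_fermDeriv, neg_zero]

@[simp] theorem berezin_empty : berezin (∅ : Finset ι) = 1 := Finset.noncommProd_empty _ _

theorem berezin_insert [DecidableEq ι] {k : ι} {S : Finset ι} (hk : k ∉ S) :
    berezin (insert k S) = pairDeriv k * berezin S :=
  Finset.noncommProd_insert_of_notMem _ _ _ _ hk

theorem berezin_insert' [DecidableEq ι] {k : ι} {S : Finset ι} (hk : k ∉ S) :
    berezin (insert k S) = berezin S * pairDeriv k :=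
  Finset.noncommProd_insert_of_notMem' _ _ _ _ hk

theorem berezin_union [DecidableEq ι] {S T : Finset ι} (hST : Disjoint S T) :
    berezin (S ∪ T) = berezin S * berezin T :=
  Finset.noncommProd_union_of_disjoint hST _ _

theorem berezin_ι_mul (S : Finset ι) (v : (ι ⊕ ι) →₀ ℝ)
    (hv : ∀ k ∈ S, v (Sum.inl k) = 0 ∧ v (Sum.inr k) = 0) (x : Grassmann ι) :
    berezin S (ExteriorAlgebra.ι ℝ v * x) = ExteriorAlgebra.ι ℝ v * berezin S x := by
  classical
  induction S using Finset.induction_on with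
  | empty => simp
  | insert k S hk ih =>
    rw [berezin_insert hk, Module.End.mul_apply, Module.End.mul_apply,
      ih fun l hl => hv l (Finset.mem_insert_of_mem hl),
      pairDeriv_ι_mul k v (hv k (by simp)).1 (hv k (by simp)).2]

theorem berezin_fermDeriv_comm (S : Finset ι) (g : ι ⊕ ι) (x : Grassmann ι) :
    berezin S (fermDeriv g x) = fermDeriv g (berezin S x) := by
  classical
  induction S using Finset.induction_on with
  | empty => simp
  | insert k S hk ih =>
    rw [berezin_insert hk, Module.End.mul_apply, Module.End.mul_apply, ih,
      pairDeriv_fermDeriv_comm]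

/-- The derivative already occurs in `berezin S` and squares to zero. This is why the fermionic half
of the supersymmetry generator integrates to zero. -/
theorem berezin_fermDeriv_of_mem {S : Finset ι} {k : ι} (hk : k ∈ S) (g : ι ⊕ ι)
    (hg : g = Sum.inl k ∨ g = Sum.inr k) (x : Grassmann ι) : berezin S (fermDeriv g x) = 0 := by
  classical
  rw [← Finset.insert_erase hk, berezin_insert' (Finset.notMem_erase _ _), Module.End.mul_apply,
    pairDeriv_fermDeriv_self k g hg, map_zero]

theorem pairDeriv_xi_mul_eta_mul (k : ι) (x : Grassmann ι) :
    pairDeriv k (xi k * eta k * x) =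
      x - eta k * fermDeriv (Sum.inr k) x - xi k * fermDeriv (Sum.inl k) x
        + xi k * (eta k * pairDeriv k x) := by
  simp only [pairDeriv, Module.End.mul_apply, xi, eta, mul_assoc, fermDeriv_ι_mul, map_sub,
    map_smul]
  simp [mul_sub]
  abel

/-- The even elements `ξ_k η_k`. -/
def xiEta (k : ι) : evenPart ι := ⟨xi k * eta k, xi_mul_eta_mem_evenPart k k⟩

/-- By `pairDeriv_xi_mul_eta_mul`, applying `∂_η ∂_ξ` to `ξ η x` gives `x` plus terms that begin
with `ξ` or `η`; those generators survive the remaining integrations and have no degree-`0` part. -/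
theorem body_berezin_prod_mul (S : Finset ι) (x : Grassmann ι) :
    body (berezin S (((∏ k ∈ S, xiEta k : evenPart ι) : Grassmann ι) * x)) = body x := by
  classical
  induction S using Finset.induction_on generalizing x with
  | empty => simp
  | insert k S hk ih =>
    have h : ∀ (g : ι ⊕ ι), g = Sum.inl k ∨ g = Sum.inr k → ∀ y : Grassmann ι,
        body (berezin S (ExteriorAlgebra.ι ℝ (Finsupp.single g 1) * y)) = 0 := by
      intro g hg y
      rw [berezin_ι_mul, body_mul, body_ι, zero_mul]
      intro l hl
      have : l ≠ k := fun e => hk (e ▸ hl)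
      rcases hg with rfl | rfl <;> simp [this]
    rw [Finset.prod_insert hk, berezin_insert' hk, Module.End.mul_apply, MulMemClass.coe_mul,
      mul_assoc, xiEta, pairDeriv_xi_mul_eta_mul, map_add, map_sub, map_sub, body_add, body_sub,
      body_sub, ih]
    unfold xi eta
    rw [h _ (Or.inl rfl), h _ (Or.inl rfl), h _ (Or.inr rfl)]
    simp

end Algebra

/-! ### Symmetry of iterated derivatives of smooth functions -/

/-- Mixed partial derivatives commute, so any slot, not only the first, may serve as the outermost
derivative. -/
theorem iteratedFDeriv_succ_apply_succAbove {E : Type*} [NormedAddCommGroup E] [NormedSpace ℝ E]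
    {F : E → ℝ} (hF : ContDiff ℝ ∞ F) {p : ℕ} (v : Fin (p + 1) → E) (r : Fin (p + 1)) (x : E) :
    iteratedFDeriv ℝ (p + 1) F x v =
      fderiv ℝ (fun y => iteratedFDeriv ℝ p F y fun j => v (r.succAbove j)) x (v r) := by
  have hD : ∀ q : ℕ, ContDiff ℝ ∞ (iteratedFDeriv ℝ q F) := fun q =>
    hF.iteratedFDeriv_right (by exact_mod_cast le_top)
  have hleft : ∀ (q : ℕ) (w : Fin (q + 1) → E) (y : E), iteratedFDeriv ℝ (q + 1) F y w =
      fderiv ℝ (fun z => iteratedFDeriv ℝ q F z (Fin.tail w)) y (w 0) := fun q w y =>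
    DifferentiableAt.iteratedFDeriv_succ_apply_left'
      ((hD q).differentiable (by simp)).differentiableAt
  induction p generalizing x with
  | zero =>
    obtain rfl : r = 0 := Fin.fin_one_eq_zero r
    rw [hleft]
    congr!
  | succ p ih =>
    refine Fin.cases ?_ (fun r' => ?_) r
    · rw [hleft]; rfl
    · rw [hleft]
      have h1 : (fun z => iteratedFDeriv ℝ (p + 1) F z (Fin.tail v)) = fun z =>
          fderiv ℝ (fun y => iteratedFDeriv ℝ p F y fun j => Fin.tail v (r'.succAbove j)) z
            (Fin.tail v r') := funext fun z => ih (Fin.tail v) r' z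
      have h2 : (fun z => iteratedFDeriv ℝ (p + 1) F z fun j => v (r'.succ.succAbove j)) = fun z =>
          fderiv ℝ (fun y => iteratedFDeriv ℝ p F y fun j => Fin.tail v (r'.succAbove j)) z
            (v 0) := by
        funext z
        rw [hleft]
        simp [Fin.tail_def]
      rw [h1, h2]
      have hg : ContDiff ℝ ∞ fun y =>
          iteratedFDeriv ℝ p F y fun j => Fin.tail v (r'.succAbove j) :=
        (ContinuousMultilinearMap.apply ℝ (fun _ : Fin p => E) ℝ
          fun j => Fin.tail v (r'.succAbove j)).contDiff.comp (hD p)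
      -- Both sides are second derivatives of the same function `g`, in the directions `v 0` and `v
      -- r'.succ` taken in opposite orders.
      generalize (fun y => iteratedFDeriv ℝ p F y fun j => Fin.tail v (r'.succAbove j)) = g at hg ⊢
      have hg' : DifferentiableAt ℝ (fderiv ℝ g) x :=
        ((hg.fderiv_right (m := ∞) le_rfl).differentiable
          (by simp)).differentiableAt
      rw [fderiv_clm_apply hg' (by fun_prop), fderiv_clm_apply hg' (by fun_prop)]
      have hs := (hg.contDiffAt (x := x)).isSymmSndFDerivAt (by simpa using ENat.LEInfty.out)
      simpa [Fin.tail_def] using hs (v 0) (v r'.succ)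

/-! ### A norm on the Grassmann algebra -/

section Norm

attribute [local instance] Matrix.linftyOpNormedRing Matrix.linftyOpNormedAlgebra

variable {ι : Type*} [Finite ι]

/-- The left regular representation of the Grassmann algebra by matrices. -/
def regularRep (ι : Type*) [Finite ι] : Grassmann ι →ₐ[ℝ]
    Matrix (Fin (Module.finrank ℝ (Grassmann ι))) (Fin (Module.finrank ℝ (Grassmann ι))) ℝ :=
  Algebra.leftMulMatrix (Module.finBasis ℝ (Grassmann ι))

/-- The operator norm is pulled back along a faithful representation, so multiplication is
continuous and products of smooth forms are smooth. In finite dimension the choice of norm is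
immaterial. -/
instance normedRing : NormedRing (Grassmann ι) :=
  NormedRing.induced _ _ (regularRep ι) (Algebra.leftMulMatrix_injective _)

instance normedAlgebra : NormedAlgebra ℝ (Grassmann ι) :=
  NormedAlgebra.induced ℝ _ _ (regularRep ι)

end Norm

/-! ### Smooth forms and the supersymmetry generator. -/

section Calculus

variable {Λ : Type*} [Fintype Λ]

theorem contDiff_linear {ι E V : Type*} [Finite ι] [NormedAddCommGroup E] [NormedSpace ℝ E]
    [NormedAddCommGroup V] [NormedSpace ℝ V] (L : Grassmann ι →ₗ[ℝ] V) {f : E → Grassmann ι}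
    (hf : ContDiff ℝ ∞ f) : ContDiff ℝ ∞ fun x => L (f x) :=
  (LinearMap.toContinuousLinearMap L).contDiff.comp hf

theorem fderiv_linear {ι E V : Type*} [Finite ι] [NormedAddCommGroup E] [NormedSpace ℝ E]
    [NormedAddCommGroup V] [NormedSpace ℝ V] (L : Grassmann ι →ₗ[ℝ] V) {f : E → Grassmann ι}
    {x : E} (hf : DifferentiableAt ℝ f x) (v : E) :
    fderiv ℝ (fun y => L (f y)) x v = L (fderiv ℝ f x v) := by
  have := ((LinearMap.toContinuousLinearMap L).hasFDerivAt.comp x hf.hasFDerivAt).fderiv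
  exact congrArg (fun T => T v) this

theorem fderiv_algebraMap {ι E : Type*} [Finite ι] [NormedAddCommGroup E] [NormedSpace ℝ E]
    {r : E → ℝ} {x : E} (hr : DifferentiableAt ℝ r x) (v : E) :
    fderiv ℝ (fun y => algebraMap ℝ (Grassmann ι) (r y)) x v =
      algebraMap ℝ (Grassmann ι) (fderiv ℝ r x v) := by
  have := ((algebraMapCLM ℝ (Grassmann ι)).hasFDerivAt.comp x hr.hasFDerivAt).fderiv
  exact congrArg (fun T => T v) this

theorem contDiff_algebraMap {ι E : Type*} [Finite ι] [NormedAddCommGroup E] [NormedSpace ℝ E]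
    {r : E → ℝ} (hr : ContDiff ℝ ∞ r) :
    ContDiff ℝ ∞ fun y => algebraMap ℝ (Grassmann ι) (r y) :=
  (algebraMapCLM ℝ (Grassmann ι)).contDiff.comp hr

/-- The coordinate vector of `φ_i^l`. -/
def coordVec (i : Λ) (l : Fin 2) : Λ → Fin 2 → ℝ :=
  open Classical in Pi.single i (Pi.single l 1)

/-- The supersymmetry generator in the first pair of odd variables,
`Q = ∑_i ξ_i ∂_{φ_i^1} + η_i ∂_{φ_i^2} + φ_i^2 ∂_{ξ_i} - φ_i^1 ∂_{η_i}`. -/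
def susy (f : Form Λ 2 2) : Form Λ 2 2 := fun φ =>
  ∑ i, (xi (i, 0) * fderiv ℝ f φ (coordVec i 0) + eta (i, 0) * fderiv ℝ f φ (coordVec i 1)
    + (φ i 1 • fermDeriv (Sum.inl (i, 0)) (f φ) - φ i 0 • fermDeriv (Sum.inr (i, 0)) (f φ)))

/-- The odd form `∑_i ∂_{φ_i^1} r ξ_i + ∂_{φ_i^2} r η_i`. -/
def oddDiff (r : (Λ → Fin 2 → ℝ) → ℝ) : Form Λ 2 2 := fun φ =>
  ∑ i, (fderiv ℝ r φ (coordVec i 0) • xi (i, 0) + fderiv ℝ r φ (coordVec i 1) • eta (i, 0))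

variable {f g : Form Λ 2 2} {φ : Λ → Fin 2 → ℝ}

/-- No sign appears: the odd coefficients of the generator pass through the even factor, and
fermionic derivatives obey the unsigned product rule on it. -/
theorem susy_mul (he : f φ ∈ evenPart (Λ × Fin 2)) (hf : DifferentiableAt ℝ f φ)
    (hg : DifferentiableAt ℝ g φ) :
    susy (fun φ => f φ * g φ) φ = susy f φ * g φ + f φ * susy g φ := by
  unfold susy
  rw [Finset.sum_mul, Finset.mul_sum, ← Finset.sum_add_distrib]
  refine Finset.sum_congr rfl fun i _ => ?_
  have h1 : ∀ v, fderiv ℝ (fun φ => f φ * g φ) φ v =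
      f φ * fderiv ℝ g φ v + fderiv ℝ f φ v * g φ := by
    intro v
    have := (hf.hasFDerivAt.mul' hg.hasFDerivAt).fderiv
    rw [show (fun φ => f φ * g φ) = f * g from rfl, this]
    simp
  have h2 : ∀ x y : Grassmann (Λ × Fin 2), x * (f φ * y) = f φ * (x * y) := fun x y => by
    rw [← mul_assoc, ← mul_comm_of_mem_evenPart he, mul_assoc]
  rw [h1, h1, fermDeriv_mul_of_mem_evenPart he, fermDeriv_mul_of_mem_evenPart he]
  simp only [mul_add, add_mul, sub_mul, mul_sub, smul_add, smul_mul_assoc, mul_smul_comm, h2,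
    mul_assoc]
  abel

theorem susy_add (hf : DifferentiableAt ℝ f φ) (hg : DifferentiableAt ℝ g φ) :
    susy (fun φ => f φ + g φ) φ = susy f φ + susy g φ := by
  unfold susy
  rw [← Finset.sum_add_distrib]
  refine Finset.sum_congr rfl fun i _ => ?_
  rw [fderiv_fun_add hf hg]
  simp only [add_apply, map_add, mul_add, smul_add]
  abel

theorem susy_sum {α : Type*} (s : Finset α) {f : α → Form Λ 2 2}
    (hf : ∀ k ∈ s, DifferentiableAt ℝ (f k) φ) :
    susy (fun φ => ∑ k ∈ s, f k φ) φ = ∑ k ∈ s, susy (f k) φ := by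
  unfold susy
  rw [Finset.sum_comm]
  refine Finset.sum_congr rfl fun i _ => ?_
  rw [fderiv_fun_sum hf]
  simp only [sum_apply, map_sum, Finset.mul_sum, Finset.smul_sum,
    ← Finset.sum_add_distrib, ← Finset.sum_sub_distrib]

/-- To be applied with `L` the Berezin integration over the second pair, on which the generator does
not act. -/
theorem susy_linear (L : Module.End ℝ (Grassmann (Λ × Fin 2))) (hf : DifferentiableAt ℝ f φ)
    (hξ : ∀ i x, L (xi (i, 0) * x) = xi (i, 0) * L x)
    (hη : ∀ i x, L (eta (i, 0) * x) = eta (i, 0) * L x)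
    (hd : ∀ g x, L (fermDeriv g x) = fermDeriv g (L x)) :
    susy (fun φ => L (f φ)) φ = L (susy f φ) := by
  unfold susy
  simp only [fderiv_linear L hf, map_sum, map_add, map_sub, hξ, hη, map_smul, hd]

theorem susy_smul (c : ℝ) (hf : DifferentiableAt ℝ f φ) :
    susy (fun φ => c • f φ) φ = c • susy f φ := by
  unfold susy
  simp only [fderiv_fun_const_smul hf, smul_apply, map_smul, Finset.smul_sum, mul_smul_comm,
    smul_add, smul_sub, smul_comm c]

theorem susy_algebraMap {r : (Λ → Fin 2 → ℝ) → ℝ} (hr : DifferentiableAt ℝ r φ) :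
    susy (fun φ => algebraMap ℝ _ (r φ)) φ = oddDiff r φ := by
  unfold susy oddDiff
  refine Finset.sum_congr rfl fun i _ => ?_
  rw [fderiv_algebraMap hr, fderiv_algebraMap hr, fermDeriv_algebraMap, fermDeriv_algebraMap,
    ← Algebra.commutes, ← Algebra.commutes, ← Algebra.smul_def, ← Algebra.smul_def]
  simp

theorem susy_smul_form {r : (Λ → Fin 2 → ℝ) → ℝ} (hr : DifferentiableAt ℝ r φ)
    (hf : DifferentiableAt ℝ f φ) :
    susy (fun φ => r φ • f φ) φ = oddDiff r φ * f φ + r φ • susy f φ := by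
  simp only [Algebra.smul_def]
  rw [susy_mul (f := fun φ => algebraMap ℝ _ (r φ)) (Subalgebra.algebraMap_mem _ _)
    ((algebraMapCLM ℝ (Grassmann (Λ × Fin 2))).differentiableAt.comp _ hr) hf, susy_algebraMap hr]

theorem oddDiff_comp {K : Type*} [Fintype K] [DecidableEq K] {G : (K → ℝ) → ℝ}
    {x : (Λ → Fin 2 → ℝ) → K → ℝ}
    (hG : DifferentiableAt ℝ G (x φ)) (hx : DifferentiableAt ℝ x φ) :
    oddDiff (fun φ => G (x φ)) φ =
      ∑ k, fderiv ℝ G (x φ) (Pi.single k 1) • oddDiff (fun φ => x φ k) φ := by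
  unfold oddDiff
  simp only [Finset.smul_sum]
  rw [Finset.sum_comm]
  refine Finset.sum_congr rfl fun i _ => ?_
  have h : ∀ v, fderiv ℝ (fun φ => G (x φ)) φ v =
      ∑ k, fderiv ℝ G (x φ) (Pi.single k 1) * fderiv ℝ (fun φ => x φ k) φ v := by
    intro v
    have h1 := (hG.hasFDerivAt.comp φ hx.hasFDerivAt).fderiv
    rw [show (fun φ => G (x φ)) = G ∘ x from rfl, h1]
    have h2 : fderiv ℝ x φ v = ∑ k, (fderiv ℝ (fun φ => x φ k) φ v) • Pi.single k (1 : ℝ) := by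
      have : ∀ k, fderiv ℝ x φ v k = fderiv ℝ (fun φ => x φ k) φ v := fun k => by
        exact (congrArg (fun T => T v) (hasFDerivAt_pi'.1 hx.hasFDerivAt k).fderiv).symm
      simp only [← this]
      exact pi_eq_sum_univ' _
    rw [ContinuousLinearMap.comp_apply, h2, map_sum]
    simp [mul_comm]
  simp only [h, Finset.sum_smul, smul_add, smul_smul, Finset.sum_add_distrib]

theorem oddDiff_comp_real {G : ℝ → ℝ} {x : (Λ → Fin 2 → ℝ) → ℝ}
    (hG : DifferentiableAt ℝ G (x φ)) (hx : DifferentiableAt ℝ x φ) :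
    oddDiff (fun φ => G (x φ)) φ = deriv G (x φ) • oddDiff x φ := by
  unfold oddDiff
  have h1 := (hG.hasDerivAt.comp_hasFDerivAt φ hx.hasFDerivAt).fderiv
  rw [show (fun φ => G (x φ)) = G ∘ x from rfl, h1, Finset.smul_sum]
  simp [smul_smul]

/-! ### Supersymmetric forms -/

/-- Smooth even forms annihilated by the supersymmetry generator. -/
structure IsSusy (f : Form Λ 2 2) : Prop where
  contDiff : ContDiff ℝ ∞ f
  mem_evenPart : ∀ φ, f φ ∈ evenPart (Λ × Fin 2)
  susy_eq_zero : ∀ φ, susy f φ = 0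

theorem ContDiff.diffAt {E V : Type*} [NormedAddCommGroup E] [NormedSpace ℝ E]
    [NormedAddCommGroup V] [NormedSpace ℝ V] {f : E → V} (hf : ContDiff ℝ ∞ f) {x : E} :
    DifferentiableAt ℝ f x := (hf.differentiable (by simp)).differentiableAt

namespace IsSusy

theorem mul (hf : IsSusy f) (hg : IsSusy g) : IsSusy fun φ => f φ * g φ where
  contDiff := hf.1.mul hg.1
  mem_evenPart φ := mul_mem (hf.2 φ) (hg.2 φ)
  susy_eq_zero φ := by
    rw [susy_mul (hf.2 φ) (ContDiff.diffAt hf.1) (ContDiff.diffAt hg.1), hf.3, hg.3, zero_mul,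
      mul_zero, add_zero]

theorem sum {α : Type*} (s : Finset α) {f : α → Form Λ 2 2} (hf : ∀ k ∈ s, IsSusy (f k)) :
    IsSusy fun φ => ∑ k ∈ s, f k φ where
  contDiff := ContDiff.sum fun k hk => (hf k hk).1
  mem_evenPart φ := sum_mem fun k hk => (hf k hk).2 φ
  susy_eq_zero φ := by
    rw [susy_sum s fun k hk => ContDiff.diffAt (hf k hk).1]
    exact Finset.sum_eq_zero fun k hk => (hf k hk).3 φ

theorem add (hf : IsSusy f) (hg : IsSusy g) : IsSusy fun φ => f φ + g φ where
  contDiff := hf.1.add hg.1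
  mem_evenPart φ := add_mem (hf.2 φ) (hg.2 φ)
  susy_eq_zero φ := by
    rw [susy_add (ContDiff.diffAt hf.1) (ContDiff.diffAt hg.1), hf.3, hg.3, add_zero]

theorem smul (c : ℝ) (hf : IsSusy f) : IsSusy fun φ => c • f φ where
  contDiff := hf.1.const_smul c
  mem_evenPart φ := Subalgebra.smul_mem _ (hf.2 φ) c
  susy_eq_zero φ := by rw [susy_smul c (ContDiff.diffAt hf.1), hf.3, smul_zero]

theorem const (c : ℝ) : IsSusy (Λ := Λ) fun _ => algebraMap ℝ _ c where
  contDiff := contDiff_const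
  mem_evenPart _ := Subalgebra.algebraMap_mem _ _
  susy_eq_zero φ := by
    rw [susy_algebraMap (by fun_prop)]
    simp [oddDiff]

theorem neg (hf : IsSusy f) : IsSusy fun φ => -f φ := by
  simpa using hf.smul (-1)

theorem sub (hf : IsSusy f) (hg : IsSusy g) : IsSusy fun φ => f φ - g φ := by
  simpa [sub_eq_add_neg] using hf.add hg.neg

theorem linear (hf : IsSusy f) (L : Module.End ℝ (Grassmann (Λ × Fin 2)))
    (he : ∀ x ∈ evenPart (Λ × Fin 2), L x ∈ evenPart (Λ × Fin 2))
    (hξ : ∀ i x, L (xi (i, 0) * x) = xi (i, 0) * L x)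
    (hη : ∀ i x, L (eta (i, 0) * x) = eta (i, 0) * L x)
    (hd : ∀ g x, L (fermDeriv g x) = fermDeriv g (L x)) : IsSusy fun φ => L (f φ) where
  contDiff := contDiff_linear L hf.1
  mem_evenPart φ := he _ (hf.2 φ)
  susy_eq_zero φ := by rw [susy_linear L (ContDiff.diffAt hf.1) hξ hη hd, hf.3, map_zero]

theorem contDiff_body (hf : IsSusy f) : ContDiff ℝ ∞ fun φ => body (f φ) :=
  contDiff_linear (ExteriorAlgebra.algebraMapInv).toLinearMap hf.1

theorem contDiff_soul (hf : IsSusy f) : ContDiff ℝ ∞ fun φ => soul (f φ) :=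
  hf.1.sub (contDiff_algebraMap hf.contDiff_body)

/-- The body and the soul add up to a closed form. This relation is what makes consecutive Taylor
terms cancel under `Q`. -/
theorem susy_soul (hf : IsSusy f) (φ : Λ → Fin 2 → ℝ) :
    susy (fun φ => soul (f φ)) φ = -oddDiff (fun φ => body (f φ)) φ := by
  have h := hf.3 φ
  have h1 : f = fun φ => algebraMap ℝ _ (body (f φ)) + soul (f φ) :=
    funext fun φ => (algebraMap_body_add_soul _).symm
  have h2 := susy_add (φ := φ)
    (ContDiff.diffAt (contDiff_algebraMap (ι := Λ × Fin 2) hf.contDiff_body))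
    (ContDiff.diffAt hf.contDiff_soul)
  rw [susy_algebraMap (ContDiff.diffAt hf.contDiff_body)] at h2
  rw [h1, h2] at h
  exact (neg_eq_of_add_eq_zero_right h).symm

end IsSusy

end Calculus

/-! ### Smooth functions of supersymmetric forms are supersymmetric. -/

section Taylor

variable {Λ : Type*} [Fintype Λ]

theorem contDiff_finset_prod_evenPart {α : Type*} (t : Finset α)
    {S : α → (Λ → Fin 2 → ℝ) → evenPart (Λ × Fin 2)}
    (hS : ∀ r ∈ t, ContDiff ℝ ∞ fun φ => (S r φ : Grassmann (Λ × Fin 2))) :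
    ContDiff ℝ ∞ fun φ => ((∏ r ∈ t, S r φ : evenPart (Λ × Fin 2)) : Grassmann (Λ × Fin 2)) := by
  classical
  induction t using Finset.induction_on with
  | empty => simpa using contDiff_const
  | insert a t ha ih =>
    simp only [Finset.prod_insert ha, MulMemClass.coe_mul]
    exact (hS a (by simp)).mul (ih fun r hr => hS r (Finset.mem_insert_of_mem hr))

theorem susy_finset_prod {α : Type*} [DecidableEq α] (t : Finset α)
    {S : α → (Λ → Fin 2 → ℝ) → evenPart (Λ × Fin 2)}
    (hS : ∀ r ∈ t, ContDiff ℝ ∞ fun φ => (S r φ : Grassmann (Λ × Fin 2)))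
    (φ : Λ → Fin 2 → ℝ) :
    susy (fun φ => ((∏ r ∈ t, S r φ : evenPart (Λ × Fin 2)) : Grassmann (Λ × Fin 2))) φ =
      ∑ r ∈ t, ((∏ r' ∈ t.erase r, S r' φ : evenPart (Λ × Fin 2)) : Grassmann (Λ × Fin 2)) *
        susy (fun φ => (S r φ : Grassmann (Λ × Fin 2))) φ := by
  induction t using Finset.induction_on with
  | empty => simpa using (IsSusy.const (Λ := Λ) 1).3 φ
  | insert a t ha ih =>
    have hS' := fun r hr => hS r (Finset.mem_insert_of_mem hr)
    simp only [Finset.prod_insert ha, MulMemClass.coe_mul]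
    rw [susy_mul (S a φ).2 (ContDiff.diffAt (hS a (by simp)))
      (ContDiff.diffAt (contDiff_finset_prod_evenPart t hS')), ih hS', Finset.sum_insert ha,
      Finset.erase_insert ha, Finset.mul_sum,
      mul_comm_of_mem_evenPart (∏ r' ∈ t, S r' φ : evenPart (Λ × Fin 2)).2]
    congr 1
    refine Finset.sum_congr rfl fun r hr => ?_
    have hra : a ≠ r := fun e => ha (e ▸ hr)
    rw [Finset.erase_insert_of_ne hra,
      Finset.prod_insert (fun h => ha (Finset.mem_of_mem_erase h)), MulMemClass.coe_mul, mul_assoc]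

/-- Write `s` for the soul and `q = Q(body a)`, so that `Q s = -q`. Applying `Q` to the Taylor term
of order `p` gives `f^(p+1) s^p q / p!` minus the same expression with `p - 1` in place of `p`. The
sum telescopes to its last term, which vanishes by nilpotency. -/
theorem IsSusy.evalOne {a : Form Λ 2 2} (ha : IsSusy a) {f : ℝ → ℝ}
    (hf : ∀ φ, ContDiffAt ℝ ∞ f (body (a φ))) : IsSusy fun φ => evalOne f (a φ) := by
  set s : Form Λ 2 2 := fun φ => soul (a φ) with hs
  have hse : ∀ φ, s φ ∈ evenPart (Λ × Fin 2) := fun φ => soul_mem_evenPart (ha.2 φ)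
  have hsd := ha.contDiff_soul
  have hD : ∀ (p : ℕ) φ, ContDiffAt ℝ ∞ (iteratedDeriv p f) (body (a φ)) := fun p φ =>
    (ContinuousMultilinearMap.apply ℝ (fun _ : Fin p => ℝ) ℝ fun _ => 1).contDiff.contDiffAt.comp _
      ((hf φ).iteratedFDeriv_right (by exact_mod_cast le_top))
  have hDc : ∀ p : ℕ, ContDiff ℝ ∞ fun φ => iteratedDeriv p f (body (a φ)) := fun p =>
    contDiff_iff_contDiffAt.2 fun φ => 
    ContDiffAt.comp (f := fun φ => body (a φ)) φ (hD p φ) ha.contDiff_body.contDiffAt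
  have hpow : ∀ p : ℕ, ContDiff ℝ ∞ fun φ => s φ ^ p := fun p => hsd.pow p
  have hsusy_pow : ∀ (p : ℕ) φ, susy (fun φ => s φ ^ (p + 1)) φ =
      ((p + 1 : ℕ) : ℝ) • (s φ ^ p * susy s φ) := by
    intro p φ
    induction p with
    | zero => simp
    | succ p ih =>
      simp only [pow_succ' _ (p + 1)]
      rw [susy_mul (hse φ) (ContDiff.diffAt hsd) (ContDiff.diffAt (hpow (p + 1))), ih,
        ← mul_comm_of_mem_evenPart (pow_mem (hse φ) (p + 1)), mul_smul_comm, ← mul_assoc,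
        ← pow_succ']
      push_cast
      rw [add_smul ((p : ℝ) + 1), one_smul, add_comm]
  have hT : ∀ p : ℕ, ContDiff ℝ ∞ fun φ =>
      ((p.factorial : ℝ)⁻¹ * iteratedDeriv p f (body (a φ))) • s φ ^ p := fun p =>
    ((contDiff_const.mul (hDc p)).smul (hpow p))
  refine ⟨ContDiff.sum fun p _ => hT p, fun φ => evalOne_mem_evenPart f (ha.2 φ), fun φ => ?_⟩
  -- One term more than in the definition: the telescoped remainder then contains the power `2 |Λ ×
  -- Fin 2| + 1` of the soul, which is zero.
  have hN : 2 * Fintype.card (Λ × Fin 2) < 2 * Fintype.card (Λ × Fin 2) + 1 + 1 := by omega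
  have heq : (fun φ => SuperHyperbolic.evalOne f (a φ)) = fun φ =>
      ∑ p ∈ Finset.range (2 * Fintype.card (Λ × Fin 2) + 1 + 1),
        ((p.factorial : ℝ)⁻¹ * iteratedDeriv p f (body (a φ))) • s φ ^ p :=
    funext fun φ => evalOne_eq_sum f (a φ) hN
  rw [heq, susy_sum _ fun p _ => ContDiff.diffAt (hT p)]
  set q := oddDiff (fun φ => body (a φ)) φ with hq
  have hcoef : ∀ p : ℕ, oddDiff (fun φ => (p.factorial : ℝ)⁻¹ * iteratedDeriv p f (body (a φ))) φ =
      ((p.factorial : ℝ)⁻¹ * iteratedDeriv (p + 1) f (body (a φ))) • q := by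
    intro p
    have hd : DifferentiableAt ℝ (iteratedDeriv p f) (body (a φ)) :=
      (hD p φ).differentiableAt (by simp)
    rw [oddDiff_comp_real (G := fun t => (p.factorial : ℝ)⁻¹ * iteratedDeriv p f t)
      (hd.const_mul _) (ContDiff.diffAt ha.contDiff_body), deriv_const_mul _ hd, iteratedDeriv_succ]
  have key : ∀ N : ℕ, ∑ p ∈ Finset.range (N + 1),
      susy (fun φ => ((p.factorial : ℝ)⁻¹ * iteratedDeriv p f (body (a φ))) • s φ ^ p) φ =
      ((N.factorial : ℝ)⁻¹ * iteratedDeriv (N + 1) f (body (a φ))) • (s φ ^ N * q) := by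
    intro N
    induction N with
    | zero =>
      rw [zero_add, Finset.sum_range_one, susy_smul_form
        (ContDiff.diffAt (contDiff_const.mul (hDc 0))) (ContDiff.diffAt (hpow 0)), hcoef]
      have : susy (fun φ => s φ ^ 0) φ = 0 := by
        simpa using (IsSusy.const (Λ := Λ) 1).3 φ
      rw [this]
      simp
    | succ N ih =>
      rw [Finset.sum_range_succ, ih, susy_smul_form
        (ContDiff.diffAt (contDiff_const.mul (hDc (N + 1)))) (ContDiff.diffAt (hpow (N + 1))),
        hcoef, hsusy_pow, ha.susy_soul, ← hq, smul_mul_assoc,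
        ← mul_comm_of_mem_evenPart (pow_mem (hse φ) (N + 1)), smul_smul, mul_neg, smul_neg]
      have hfac : (((N + 1).factorial : ℝ)⁻¹ * iteratedDeriv (N + 1) f (body (a φ))) *
          ((N + 1 : ℕ) : ℝ) = (N.factorial : ℝ)⁻¹ * iteratedDeriv (N + 1) f (body (a φ)) := by
        rw [Nat.factorial_succ]
        have := Nat.cast_ne_zero (R := ℝ).2 (Nat.factorial_ne_zero N)
        push_cast
        field_simp
      rw [hfac]
      abel
  rw [key, hs, soul_pow_eq_zero _ (by omega), zero_mul, smul_zero]

/-- Splitting off the index in slot `r` and using symmetry of derivatives gives a value that does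
not depend on `r`, so all slots contribute equally. -/
theorem sum_mul_oddDiff_erase {E : Type*} [NormedAddCommGroup E] [NormedSpace ℝ E] {ι K : Type*}
    [Fintype K] {F : E → ℝ} (hF : ContDiff ℝ ∞ F) (x : E) (e : K → E) (S : K → evenPart ι)
    (q : K → Grassmann ι) {p : ℕ} (r : Fin (p + 1)) :
    ∑ k : Fin (p + 1) → K, iteratedFDeriv ℝ (p + 1) F x (fun j => e (k j)) •
        (((∏ j ∈ Finset.univ.erase r, S (k j) : evenPart ι) : Grassmann ι) * q (k r)) =
      ∑ k : Fin p → K, ∑ l, fderiv ℝ (fun y => iteratedFDeriv ℝ p F y fun j => e (k j)) x (e l) •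
        (((∏ j, S (k j) : evenPart ι) : Grassmann ι) * q l) := by
  rw [← (Fin.insertNthEquiv (fun _ => K) r).sum_comp, Fintype.sum_prod_type_right]
  refine Finset.sum_congr rfl fun k _ => Finset.sum_congr rfl fun l _ => ?_
  rw [iteratedFDeriv_succ_apply_succAbove hF _ r]
  have : Finset.univ.erase r = Finset.univ.map r.succAboveEmb := by
    rw [Fin.univ_succAbove p r, Finset.erase_cons]
  rw [this, Finset.prod_map]
  simp [Fin.insertNthEquiv]

/-- The telescoping is that of one variable, with `W p` as the boundary term of order `p`. Hitting
each of the `p + 1` souls with `Q` gives the same sum `W p`. -/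
theorem IsSusy.evalMany {K : Type*} [Fintype K] {a : K → Form Λ 2 2} (ha : ∀ k, IsSusy (a k))
    {F : (K → ℝ) → ℝ} (hF : ContDiff ℝ ∞ F) : IsSusy fun φ => evalMany F fun k => a k φ := by
  classical
  set S : K → (Λ → Fin 2 → ℝ) → evenPart (Λ × Fin 2) := fun k φ =>
    ⟨soul (a k φ), soul_mem_evenPart ((ha k).2 φ)⟩ with hS
  have hSd : ∀ k, ContDiff ℝ ∞ fun φ => (S k φ : Grassmann (Λ × Fin 2)) :=
    fun k => (ha k).contDiff_soul
  set x : (Λ → Fin 2 → ℝ) → K → ℝ := fun φ k => body (a k φ) with hx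
  have hxd : ContDiff ℝ ∞ x := contDiff_pi.2 fun k => (ha k).contDiff_body
  have hD : ∀ (p : ℕ) (v : Fin p → K → ℝ), ContDiff ℝ ∞ fun y => iteratedFDeriv ℝ p F y v :=
    fun p v => (ContinuousMultilinearMap.apply ℝ (fun _ : Fin p => K → ℝ) ℝ v).contDiff.comp
      (hF.iteratedFDeriv_right (by exact_mod_cast le_top))
  have hP : ∀ (p : ℕ) (k : Fin p → K), ContDiff ℝ ∞ fun φ =>
      ((∏ r, S (k r) φ : evenPart (Λ × Fin 2)) : Grassmann (Λ × Fin 2)) := fun p k =>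
    contDiff_finset_prod_evenPart _ fun r _ => hSd (k r)
  set e : K → K → ℝ := fun k => Pi.single k 1 with he
  have hc : ∀ (p : ℕ) (k : Fin p → K), ContDiff ℝ ∞ fun φ =>
      (p.factorial : ℝ)⁻¹ * iteratedFDeriv ℝ p F (x φ) fun r => e (k r) := fun p k =>
    contDiff_const.mul ((hD p _).comp hxd)
  have hT : ∀ (p : ℕ) (k : Fin p → K), ContDiff ℝ ∞ fun φ =>
      ((p.factorial : ℝ)⁻¹ * iteratedFDeriv ℝ p F (x φ) fun r => e (k r)) •
        ((∏ r, S (k r) φ : evenPart (Λ × Fin 2)) : Grassmann (Λ × Fin 2)) := fun p k =>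
    (hc p k).smul (hP p k)
  have hN : 2 * Fintype.card (Λ × Fin 2) < 2 * Fintype.card (Λ × Fin 2) + 1 + 1 := by omega
  have hprod : ∀ (p : ℕ) (k : Fin p → K) φ, (List.ofFn fun r => soul (a (k r) φ)).prod =
      ((∏ r, S (k r) φ : evenPart (Λ × Fin 2)) : Grassmann (Λ × Fin 2)) := by
    intro p k φ
    rw [← List.prod_ofFn, ← Subalgebra.coe_val, map_list_prod, List.map_ofFn]
    rfl
  have heq : (fun φ => SuperHyperbolic.evalMany F fun k => a k φ) = fun φ =>
      ∑ p ∈ Finset.range (2 * Fintype.card (Λ × Fin 2) + 1 + 1), ∑ k : Fin p → K,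
      ((p.factorial : ℝ)⁻¹ * iteratedFDeriv ℝ p F (x φ) fun r => e (k r)) •
        ((∏ r, S (k r) φ : evenPart (Λ × Fin 2)) : Grassmann (Λ × Fin 2)) := by
    funext φ
    rw [evalMany_eq_sum F _ hN]
    simp only [hprod, hx, he]
  refine ⟨?_, fun φ => evalMany_mem_evenPart F fun k => (ha k).2 φ, fun φ => ?_⟩
  · rw [heq]
    exact ContDiff.sum fun p _ => ContDiff.sum fun k _ => hT p k
  rw [heq, susy_sum _ fun p _ => ContDiff.diffAt (ContDiff.sum fun k _ => hT p k)]
  set q : K → Grassmann (Λ × Fin 2) := fun k => oddDiff (fun φ => x φ k) φ with hq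
  set W : ℕ → Grassmann (Λ × Fin 2) := fun p => ∑ k : Fin p → K, ∑ l,
    fderiv ℝ (fun y => iteratedFDeriv ℝ p F y fun j => e (k j)) (x φ) (e l) •
        (((∏ j, S (k j) φ : evenPart (Λ × Fin 2)) : Grassmann (Λ × Fin 2)) * q l) with hW
  have hterm : ∀ (p : ℕ) (k : Fin p → K), susy (fun φ =>
      ((p.factorial : ℝ)⁻¹ * iteratedFDeriv ℝ p F (x φ) fun r => e (k r)) •
        ((∏ r, S (k r) φ : evenPart (Λ × Fin 2)) : Grassmann (Λ × Fin 2))) φ =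
      (p.factorial : ℝ)⁻¹ • (∑ l,
        fderiv ℝ (fun y => iteratedFDeriv ℝ p F y fun j => e (k j)) (x φ) (e l) •
        (((∏ j, S (k j) φ : evenPart (Λ × Fin 2)) : Grassmann (Λ × Fin 2)) * q l))
      - (p.factorial : ℝ)⁻¹ • ∑ r, iteratedFDeriv ℝ p F (x φ) (fun j => e (k j)) •
        (((∏ j ∈ Finset.univ.erase r, S (k j) φ : evenPart (Λ × Fin 2)) :
          Grassmann (Λ × Fin 2)) * q (k r)) := by
    intro p k
    rw [susy_smul_form (ContDiff.diffAt (hc p k)) (ContDiff.diffAt (hP p k)),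
      susy_finset_prod _ fun r _ => hSd (k r),
      oddDiff_comp (G := fun y => (p.factorial : ℝ)⁻¹ * iteratedFDeriv ℝ p F y fun r => e (k r))
        (ContDiff.diffAt (contDiff_const.mul (hD p _))) (ContDiff.diffAt hxd),
      sub_eq_add_neg]
    congr 1
    · rw [Finset.smul_sum, Finset.sum_mul]
      refine Finset.sum_congr rfl fun l _ => ?_
      rw [fderiv_const_mul (ContDiff.diffAt (hD p _)), smul_apply, smul_mul_assoc,
        mul_comm_of_mem_evenPart (∏ j, S (k j) φ : evenPart (Λ × Fin 2)).2, smul_smul, smul_eq_mul]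
    · rw [mul_smul, ← smul_neg, Finset.smul_sum, ← Finset.sum_neg_distrib]
      congr 1
      refine Finset.sum_congr rfl fun r _ => ?_
      rw [(ha (k r)).susy_soul, mul_neg, smul_neg]
  have hsum0 : susy (fun φ => ∑ k : Fin 0 → K,
      (((0 : ℕ).factorial : ℝ)⁻¹ * iteratedFDeriv ℝ 0 F (x φ) fun r => e (k r)) •
        ((∏ r, S (k r) φ : evenPart (Λ × Fin 2)) : Grassmann (Λ × Fin 2))) φ = W 0 := by
    rw [susy_sum _ fun k _ => ContDiff.diffAt (hT 0 k)]
    simp only [hterm, hW]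
    simp
  have hsum : ∀ p : ℕ, susy (fun φ => ∑ k : Fin (p + 1) → K,
      (((p + 1).factorial : ℝ)⁻¹ * iteratedFDeriv ℝ (p + 1) F (x φ) fun r => e (k r)) •
        ((∏ r, S (k r) φ : evenPart (Λ × Fin 2)) : Grassmann (Λ × Fin 2))) φ =
      ((p + 1).factorial : ℝ)⁻¹ • W (p + 1) - (p.factorial : ℝ)⁻¹ • W p := by
    intro p
    rw [susy_sum _ fun k _ => ContDiff.diffAt (hT (p + 1) k)]
    simp only [hterm, Finset.sum_sub_distrib]
    rw [← Finset.smul_sum, ← Finset.smul_sum]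
    congr 1
    -- The `p + 1` equal slots turn `1 / (p + 1)!` into `1 / p!`.
    rw [Finset.sum_comm, Finset.sum_congr rfl fun r _ => sum_mul_oddDiff_erase hF (x φ) e
      (fun k => S k φ) q r, Finset.sum_const, Finset.card_univ, Fintype.card_fin,
      ← Nat.cast_smul_eq_nsmul ℝ, smul_smul]
    congr 1
    rw [Nat.factorial_succ]
    have := Nat.cast_ne_zero (R := ℝ).2 (Nat.factorial_ne_zero p)
    push_cast
    field_simp
  have key : ∀ N : ℕ, ∑ p ∈ Finset.range (N + 1), susy (fun φ => ∑ k : Fin p → K,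
      ((p.factorial : ℝ)⁻¹ * iteratedFDeriv ℝ p F (x φ) fun r => e (k r)) •
        ((∏ r, S (k r) φ : evenPart (Λ × Fin 2)) : Grassmann (Λ × Fin 2))) φ =
      (N.factorial : ℝ)⁻¹ • W N := by
    intro N
    induction N with
    | zero => rw [zero_add, Finset.sum_range_one, hsum0]; simp
    | succ N ih => rw [Finset.sum_range_succ, ih, hsum]; abel
  rw [key, hW]
  refine smul_eq_zero_of_right _ (Finset.sum_eq_zero fun k _ => Finset.sum_eq_zero fun l _ => ?_)
  rw [← hprod, list_prod_eq_zero, zero_mul, smul_zero]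
  · intro b hb
    obtain ⟨r, rfl⟩ := List.mem_ofFn.1 hb
    exact body_soul _
  · simp

end Taylor

/-! ### Test functions and cutoffs of one real variable. -/

/-- Smooth functions of one variable with compact support. -/
structure IsTest (χ : ℝ → ℝ) : Prop where
  contDiff : ContDiff ℝ ∞ χ
  compact : HasCompactSupport χ

open Filter Topology in
/-- Smooth functions of one variable with compact support that equal `1` near `0`. -/
structure IsCutoff (χ : ℝ → ℝ) : Prop extends IsTest χ where
  eventually_one : χ =ᶠ[𝓝 0] 1

theorem exists_isCutoff : ∃ χ : ℝ → ℝ, IsCutoff χ := by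
  let b : ContDiffBump (0 : ℝ) := ⟨1, 2, one_pos, one_lt_two⟩
  exact ⟨b, ⟨b.contDiff, b.hasCompactSupport⟩, b.eventuallyEq_one⟩

theorem IsTest.continuous_deriv {χ : ℝ → ℝ} (h : IsTest χ) : Continuous (deriv χ) :=
  h.contDiff.continuous_deriv (by simp)

theorem IsTest.contDiff_deriv {χ : ℝ → ℝ} (h : IsTest χ) : ContDiff ℝ ∞ (deriv χ) :=
  ((contDiff_infty_iff_deriv (f := χ)).1 h.contDiff).2

theorem IsTest.exists_zero {χ : ℝ → ℝ} (h : IsTest χ) :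
    ∃ R : ℝ, ∀ x, R < x → χ x = 0 ∧ deriv χ x = 0 := by
  obtain ⟨R, hR⟩ := h.compact.isCompact.isBounded.subset_closedBall 0
  refine ⟨R, fun x hx => ?_⟩
  have hx' : x ∉ tsupport χ := fun hmem => by
    have := hR hmem
    rw [Metric.mem_closedBall, dist_zero_right, Real.norm_eq_abs] at this
    exact absurd (le_abs_self x) (not_le.2 (this.trans_lt hx))
  exact ⟨image_eq_zero_of_notMem_tsupport hx', image_eq_zero_of_notMem_tsupport
    fun hd => hx' (tsupport_deriv_subset hd)⟩

theorem IsCutoff.zero {χ : ℝ → ℝ} (h : IsCutoff χ) : χ 0 = 1 := h.eventually_one.self_of_nhds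

theorem IsCutoff.comp_mul_left {χ : ℝ → ℝ} (h : IsCutoff χ) {a : ℝ} (ha : 0 < a) :
    IsCutoff fun x => χ (a * x) where
  contDiff := h.contDiff.comp (contDiff_const.mul contDiff_id)
  compact := by
    have := h.compact.comp_homeomorph (Homeomorph.mulLeft₀ a ha.ne')
    exact this
  eventually_one := by
    have : Filter.Tendsto (fun x : ℝ => a * x) (nhds 0) (nhds 0) := by
      simpa using (continuous_const_mul a).tendsto (0 : ℝ)
    exact this.eventually h.eventually_one

/-- Hadamard quotient of the difference of two cutoff functions. -/
theorem IsCutoff.exists_sub_eq_mul {χ χ' : ℝ → ℝ} (h : IsCutoff χ) (h' : IsCutoff χ') :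
    ∃ θ : ℝ → ℝ, IsTest θ ∧ ∀ x, χ x - χ' x = x * θ x := by
  -- Both cutoffs equal `1` near `0`, so the quotient vanishes there and is smooth; at `0` itself
  -- `0⁻¹ = 0` gives the right value.
  refine ⟨fun x => (χ x - χ' x) * x⁻¹, ⟨contDiff_iff_contDiffAt.2 fun x => ?_, ?_⟩, fun x => ?_⟩
  · rcases eq_or_ne x 0 with rfl | hx
    · have : (fun x => (χ x - χ' x) * x⁻¹) =ᶠ[nhds 0] fun _ => 0 := by
        filter_upwards [h.eventually_one, h'.eventually_one] with x h1 h2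
        simp [h1, h2]
      exact contDiffAt_const.congr_of_eventuallyEq this
    · exact ((h.contDiff.sub h'.contDiff).contDiffAt).mul (contDiffAt_inv ℝ hx)
  · have h1 : HasCompactSupport (χ + -χ') := h.compact.add h'.compact.neg
    have h2 := h1.mul_right (f' := fun x : ℝ => x⁻¹)
    have e : (χ + -χ') * (fun x : ℝ => x⁻¹) = fun x => (χ x - χ' x) * x⁻¹ := by
      funext x
      simp [sub_eq_add_neg]
    rwa [e] at h2
  · rcases eq_or_ne x 0 with rfl | hx
    · simp [h.zero, h'.zero]
    · field_simp

/-! ### Supersymmetric cutoffs and independence of the cutoff. -/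

section Localization

variable {Λ : Type*} [Fintype Λ]

theorem contDiff_smul_form {r : (Λ → Fin 2 → ℝ) → ℝ} {f : Form Λ 2 2} (hr : ContDiff ℝ ∞ r)
    (hf : ContDiff ℝ ∞ f) : ContDiff ℝ ∞ fun φ => r φ • f φ := hr.smul hf

/-- The squared length of `φ_i`. -/
def rad (i : Λ) (φ : Λ → Fin 2 → ℝ) : ℝ := φ i 0 ^ 2 + φ i 1 ^ 2

theorem contDiff_coord (i : Λ) (l : Fin 2) : ContDiff ℝ ∞ fun φ : Λ → Fin 2 → ℝ => φ i l :=
  contDiff_apply_apply ℝ ℝ i l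

theorem contDiff_rad (i : Λ) : ContDiff ℝ ∞ (rad i) :=
  ((contDiff_coord i 0).pow 2).add ((contDiff_coord i 1).pow 2)

theorem fderiv_coord {Λ : Type*} [DecidableEq Λ] (i j : Λ) (l l' : Fin 2) (φ : Λ → Fin 2 → ℝ) :
    fderiv ℝ (fun φ : Λ → Fin 2 → ℝ => φ i l) φ (coordVec j l') =
      if i = j ∧ l = l' then 1 else 0 := by
  have h : HasFDerivAt (fun φ : Λ → Fin 2 → ℝ => φ i l)
      ((ContinuousLinearMap.proj (R := ℝ) (φ := fun _ : Fin 2 => ℝ) l).comp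
        (ContinuousLinearMap.proj (R := ℝ) (φ := fun _ : Λ => Fin 2 → ℝ) i)) φ :=
    (((ContinuousLinearMap.proj (R := ℝ) (φ := fun _ : Fin 2 => ℝ) l).comp
        (ContinuousLinearMap.proj (R := ℝ) (φ := fun _ : Λ => Fin 2 → ℝ) i))).hasFDerivAt
  rw [h.fderiv]
  by_cases hij : i = j
  · subst hij
    by_cases hl : l = l'
    · subst hl; simp [coordVec]
    · simp [coordVec, hl]
  · simp [coordVec, hij]

theorem oddDiff_coord_zero (i : Λ) (φ : Λ → Fin 2 → ℝ) :
    oddDiff (fun φ => φ i 0) φ = xi (i, 0) := by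
  classical
  simp [oddDiff, fderiv_coord]

theorem oddDiff_coord_one (i : Λ) (φ : Λ → Fin 2 → ℝ) :
    oddDiff (fun φ => φ i 1) φ = eta (i, 0) := by
  classical
  simp [oddDiff, fderiv_coord]

theorem oddDiff_rad (i : Λ) (φ : Λ → Fin 2 → ℝ) :
    oddDiff (rad i) φ = (2 * φ i 0) • xi (i, 0) + (2 * φ i 1) • eta (i, 0) := by
  classical
  have h : ∀ v, fderiv ℝ (rad i) φ v = 2 * φ i 0 * fderiv ℝ (fun φ => φ i 0) φ v +
      2 * φ i 1 * fderiv ℝ (fun φ => φ i 1) φ v := by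
    intro v
    have h0 := (ContDiff.diffAt (contDiff_coord i 0) (x := φ)).hasFDerivAt
    have h1 := (ContDiff.diffAt (contDiff_coord i 1) (x := φ)).hasFDerivAt
    have := ((h0.pow 2).add (h1.pow 2)).fderiv
    rw [show rad i = (fun φ : Λ → Fin 2 → ℝ => φ i 0 ^ 2) + fun φ => φ i 1 ^ 2 from rfl, this]
    simp
  unfold oddDiff
  simp [h, fderiv_coord, Finset.sum_add_distrib]

/-- Signed product rule for an odd factor; the scalar coefficient is the image of `v` under the
generator, with `Qξ_i = φ_i^2` and `Qη_i = -φ_i^1`. -/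
theorem susy_ι_mul (v : ((Λ × Fin 2) ⊕ (Λ × Fin 2)) →₀ ℝ) {g : Form Λ 2 2}
    {φ : Λ → Fin 2 → ℝ} (hg : DifferentiableAt ℝ g φ) :
    susy (fun φ => ExteriorAlgebra.ι ℝ v * g φ) φ =
      (∑ i, (φ i 1 * v (Sum.inl (i, 0)) - φ i 0 * v (Sum.inr (i, 0)))) • g φ
        - ExteriorAlgebra.ι ℝ v * susy g φ := by
  have hfd : ∀ w, fderiv ℝ (fun φ => ExteriorAlgebra.ι ℝ v * g φ) φ w =
      ExteriorAlgebra.ι ℝ v * fderiv ℝ g φ w := fun w =>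
    fderiv_linear (LinearMap.mulLeft ℝ (ExteriorAlgebra.ι ℝ v)) hg w
  have hc : ∀ (w : ((Λ × Fin 2) ⊕ (Λ × Fin 2)) →₀ ℝ) (x : Grassmann (Λ × Fin 2)),
      ExteriorAlgebra.ι ℝ w * (ExteriorAlgebra.ι ℝ v * x) =
        -(ExteriorAlgebra.ι ℝ v * (ExteriorAlgebra.ι ℝ w * x)) := fun w x => by
    rw [← mul_assoc, ι_anticomm, neg_mul, mul_assoc]
  unfold susy
  rw [Finset.sum_smul, Finset.mul_sum, ← Finset.sum_sub_distrib]
  refine Finset.sum_congr rfl fun i _ => ?_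
  simp only [xi, eta, hfd, hc, fermDeriv_ι_mul, mul_add, mul_sub, smul_sub, mul_smul_comm,
    sub_smul, mul_smul]
  abel

/-- The odd form `φ_i^2 ξ_i - φ_i^1 η_i`. -/
def pot (i : Λ) : Form Λ 2 2 := fun φ => φ i 1 • xi (i, 0) - φ i 0 • eta (i, 0)

theorem contDiff_pot (i : Λ) : ContDiff ℝ ∞ (pot i) :=
  (contDiff_smul_form (contDiff_coord i 1) contDiff_const).sub
    (contDiff_smul_form (contDiff_coord i 0) contDiff_const)

/-- The first factor on the right is `Q (pot i) = |φ_i|^2 - 2 ξ_i η_i`, exactly the argument of the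
cutoff forms. Hence a closed multiple of it is exact. -/
theorem susy_pot_mul (i : Λ) {g : Form Λ 2 2} {φ : Λ → Fin 2 → ℝ}
    (hg : ContDiff ℝ ∞ g) :
    susy (fun φ => pot i φ * g φ) φ =
      (rad i φ • (1 : Grassmann (Λ × Fin 2)) - (2 : ℝ) • (xi (i, 0) * eta (i, 0))) * g φ
        - pot i φ * susy g φ := by
  classical
  have hξ : ContDiff ℝ ∞ fun φ => xi (i, 0) * g φ := contDiff_const.mul hg
  have hη : ContDiff ℝ ∞ fun φ => eta (i, 0) * g φ := contDiff_const.mul hg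
  have e : (fun φ => pot i φ * g φ) = fun φ =>
      φ i 1 • (xi (i, 0) * g φ) + (-1 : ℝ) • (φ i 0 • (eta (i, 0) * g φ)) := by
    funext φ
    simp [pot, add_mul, sub_eq_add_neg]
  have e1 : susy (fun φ => xi (i, 0) * g φ) φ = φ i 1 • g φ - xi (i, 0) * susy g φ := by
    unfold xi
    rw [susy_ι_mul _ (ContDiff.diffAt hg)]
    simp [Finsupp.single_apply]
  have e2 : susy (fun φ => eta (i, 0) * g φ) φ = -(φ i 0) • g φ - eta (i, 0) * susy g φ := by
    unfold eta
    rw [susy_ι_mul _ (ContDiff.diffAt hg)]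
    simp [Finsupp.single_apply]
  rw [e, susy_add (ContDiff.diffAt (contDiff_smul_form (contDiff_coord i 1) hξ))
      (ContDiff.diffAt ((contDiff_smul_form (contDiff_coord i 0) hη).const_smul _)),
    susy_smul _ (ContDiff.diffAt (contDiff_smul_form (contDiff_coord i 0) hη)),
    susy_smul_form (ContDiff.diffAt (contDiff_coord i 1)) (ContDiff.diffAt hξ),
    susy_smul_form (ContDiff.diffAt (contDiff_coord i 0)) (ContDiff.diffAt hη),
    oddDiff_coord_zero, oddDiff_coord_one, e1, e2]
  have hanti : eta (i, 0) * (xi (i, 0) * g φ) = -(xi (i, 0) * (eta (i, 0) * g φ)) := by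
    rw [← mul_assoc, eta, xi, ι_anticomm, neg_mul, mul_assoc]
  rw [hanti]
  simp only [pot, rad, sub_mul, smul_sub, smul_smul, smul_mul_assoc, one_mul, smul_add, mul_assoc]
  module

/-- The even form `χ(|φ_i|^2 - 2 ξ_i η_i)`, expanded. -/
def cut (χ : ℝ → ℝ) (i : Λ) (φ : Λ → Fin 2 → ℝ) : evenPart (Λ × Fin 2) :=
  (-2 * deriv χ (rad i φ)) • xiEta (i, 0) + χ (rad i φ) • 1

theorem contDiff_cut {χ : ℝ → ℝ} (hχ : IsTest χ) (i : Λ) :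
    ContDiff ℝ ∞ fun φ => (cut χ i φ : Grassmann (Λ × Fin 2)) :=
  (contDiff_smul_form (contDiff_const.mul (hχ.contDiff_deriv.comp (contDiff_rad i)))
    contDiff_const).add (contDiff_smul_form (hχ.contDiff.comp (contDiff_rad i)) contDiff_const)

/-- Since `Q|φ_i|^2 = 2 Q(ξ_i η_i) = 2(φ_i^1 ξ_i + φ_i^2 η_i)`, the terms with `χ'` cancel; the term
with `χ''` carries `ξ_i^2` or `η_i^2` and vanishes. -/
theorem isSusy_cut {χ : ℝ → ℝ} (hχ : IsTest χ) (i : Λ) :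
    IsSusy fun φ => (cut χ i φ : Grassmann (Λ × Fin 2)) where
  contDiff := contDiff_cut hχ i
  mem_evenPart φ := (cut χ i φ).2
  susy_eq_zero φ := by
    classical
    have d1 : ContDiff ℝ ∞ fun φ : Λ → Fin 2 → ℝ => -2 * deriv χ (rad i φ) :=
      contDiff_const.mul (hχ.contDiff_deriv.comp (contDiff_rad i))
    have d0 : ContDiff ℝ ∞ fun φ : Λ → Fin 2 → ℝ => χ (rad i φ) := hχ.contDiff.comp (contDiff_rad i)
    have c1 : ContDiff ℝ ∞ fun _ : Λ → Fin 2 → ℝ => (xi (i, 0) * eta (i, 0) :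
      Grassmann (Λ × Fin 2)) := contDiff_const
    have c0 : ContDiff ℝ ∞ fun _ : Λ → Fin 2 → ℝ => (1 : Grassmann (Λ × Fin 2)) := contDiff_const
    change susy (fun φ => (-2 * deriv χ (rad i φ)) • (xi (i, 0) * eta (i, 0) :
      Grassmann (Λ × Fin 2)) + χ (rad i φ) • (1 : Grassmann (Λ × Fin 2))) φ = 0
    rw [susy_add (ContDiff.diffAt (contDiff_smul_form d1 c1))
      (ContDiff.diffAt (contDiff_smul_form d0 c0)),
      susy_smul_form (ContDiff.diffAt d1) (ContDiff.diffAt c1),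
      susy_smul_form (ContDiff.diffAt d0) (ContDiff.diffAt c0),
      oddDiff_comp_real (G := fun t => -2 * deriv χ t)
        (ContDiff.diffAt (contDiff_const.mul hχ.contDiff_deriv)) (ContDiff.diffAt (contDiff_rad i)),
      oddDiff_comp_real (ContDiff.diffAt hχ.contDiff) (ContDiff.diffAt (contDiff_rad i)),
      oddDiff_rad]
    have e1 : susy (fun _ => (1 : Grassmann (Λ × Fin 2))) φ = 0 := by
      simpa using (IsSusy.const (Λ := Λ) 1).3 φ
    have e3 : susy (fun _ => eta (i, 0)) φ = -(φ i 0) • (1 : Grassmann (Λ × Fin 2)) := by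
      have := susy_ι_mul (Finsupp.single (Sum.inr (i, 0)) 1) (ContDiff.diffAt c0 (x := φ))
      simp only [mul_one, e1] at this
      unfold eta
      rw [this]
      simp [Finsupp.single_apply]
    have e2 : susy (fun _ => xi (i, 0) * eta (i, 0)) φ =
        φ i 1 • eta (i, 0) + φ i 0 • xi (i, 0) := by
      unfold xi
      rw [susy_ι_mul _ (ContDiff.diffAt contDiff_const), e3]
      simp [Finsupp.single_apply]
    have x0 : xi (i, 0) * (xi (i, 0) * eta (i, 0)) = (0 : Grassmann (Λ × Fin 2)) := by
      rw [← mul_assoc, xi, ExteriorAlgebra.ι_sq_zero, zero_mul]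
    have x1 : eta (i, 0) * (xi (i, 0) * eta (i, 0)) = (0 : Grassmann (Λ × Fin 2)) := by
      rw [← mul_assoc, xi, eta, ι_anticomm, neg_mul, mul_assoc, ExteriorAlgebra.ι_sq_zero, mul_zero,
        neg_zero]
    rw [e1, e2, smul_mul_assoc, add_mul, smul_mul_assoc, smul_mul_assoc, x0, x1]
    simp only [mul_one, smul_add, smul_zero, smul_smul]
    module

/-- The identity `χ - χ' = x θ` is evaluated at `|φ_i|^2 - 2 ξ_i η_i`: its value gives the scalar
part and its derivative the coefficient of `ξ_i η_i`. -/
theorem cut_sub_cut {χ χ' θ : ℝ → ℝ} (hχ : IsTest χ) (hχ' : IsTest χ') (hθ : IsTest θ)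
    (h : ∀ x, χ x - χ' x = x * θ x) (i : Λ) (φ : Λ → Fin 2 → ℝ) :
    (cut χ i φ : Grassmann (Λ × Fin 2)) - (cut χ' i φ : Grassmann (Λ × Fin 2)) =
      (rad i φ • (1 : Grassmann (Λ × Fin 2)) - (2 : ℝ) • (xi (i, 0) * eta (i, 0))) *
        (cut θ i φ : Grassmann (Λ × Fin 2)) := by
  have hd : ∀ x, deriv χ x - deriv χ' x = θ x + x * deriv θ x := by
    intro x
    rw [← deriv_fun_sub (ContDiff.diffAt hχ.contDiff) (ContDiff.diffAt hχ'.contDiff)]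
    simp only [h]
    rw [deriv_fun_mul (by fun_prop) (ContDiff.diffAt hθ.contDiff)]
    simp
  have sq : xi (i, 0) * eta (i, 0) * (xi (i, 0) * eta (i, 0)) = (0 : Grassmann (Λ × Fin 2)) := by
    rw [mul_assoc, ← mul_assoc (eta (i, 0)), xi, eta, ι_anticomm, neg_mul, mul_neg, ← mul_assoc,
      ← mul_assoc, ExteriorAlgebra.ι_sq_zero]
    simp
  have e : ∀ χ : ℝ → ℝ, (cut χ i φ : Grassmann (Λ × Fin 2)) =
      (-2 * deriv χ (rad i φ)) • (xi (i, 0) * eta (i, 0)) + χ (rad i φ) • 1 := fun _ => rfl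
  have h1 := h (rad i φ)
  have h2 := hd (rad i φ)
  rw [e, e, e, sub_mul, mul_add, mul_add, smul_mul_smul_comm, smul_mul_smul_comm,
    smul_mul_smul_comm, smul_mul_smul_comm, sq, one_mul, one_mul, mul_one, smul_zero]
  rw [sub_eq_iff_eq_add] at h1 h2
  rw [h1, h2]
  module

/-- The product of the cutoff forms over all sites. -/
def cutProd (X : Λ → ℝ → ℝ) (φ : Λ → Fin 2 → ℝ) : evenPart (Λ × Fin 2) := ∏ i, cut (X i) i φ

theorem cutProd_update [DecidableEq Λ] (X : Λ → ℝ → ℝ) (i : Λ) (χ : ℝ → ℝ)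
    (φ : Λ → Fin 2 → ℝ) :
    cutProd (Function.update X i χ) φ = cut χ i φ * ∏ j ∈ Finset.univ.erase i, cut (X j) j φ := by
  unfold cutProd
  rw [← Finset.mul_prod_erase _ _ (Finset.mem_univ i), Function.update_self]
  congr 1
  refine Finset.prod_congr rfl fun j hj => ?_
  rw [Function.update_of_ne (Finset.ne_of_mem_erase hj)]

theorem isSusy_prod_cut {X : Λ → ℝ → ℝ} (hX : ∀ i, IsTest (X i)) (s : Finset Λ) :
    IsSusy fun φ => ((∏ i ∈ s, cut (X i) i φ : evenPart (Λ × Fin 2)) :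
      Grassmann (Λ × Fin 2)) := by
  classical
  refine ⟨contDiff_finset_prod_evenPart s fun i _ => contDiff_cut (hX i) i,
    fun φ => (∏ i ∈ s, cut (X i) i φ).2, fun φ => ?_⟩
  rw [susy_finset_prod s fun i _ => contDiff_cut (hX i) i]
  exact Finset.sum_eq_zero fun i _ => by rw [(isSusy_cut (hX i) i).3, mul_zero]

theorem exists_radius {X : Λ → ℝ → ℝ} (hX : ∀ i, IsTest (X i)) :
    ∃ r : ℝ, ∀ φ : Λ → Fin 2 → ℝ, r < ‖φ‖ →
      ∃ i, X i (rad i φ) = 0 ∧ deriv (X i) (rad i φ) = 0 := by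
  choose R hR using fun i => (hX i).exists_zero
  -- A coordinate larger than this in absolute value exceeds `1`, so its square also exceeds `R i`.
  refine ⟨1 + ∑ i, |R i|, fun φ hφ => ?_⟩
  have hpos : 1 ≤ 1 + ∑ i, |R i| := by
    have := Finset.sum_nonneg fun i (_ : i ∈ Finset.univ) => abs_nonneg (R i)
    linarith
  have : ∃ i l, 1 + ∑ i, |R i| < |φ i l| := by
    by_contra! hcon
    exact absurd hφ (not_lt.2 ((pi_norm_le_iff_of_nonneg (by linarith)).2 fun i =>
      (pi_norm_le_iff_of_nonneg (by linarith)).2 fun l => hcon i l))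
  obtain ⟨i, l, hil⟩ := this
  refine ⟨i, hR i _ ?_⟩
  have h1 : |φ i l| ^ 2 ≤ rad i φ := by
    rw [sq_abs, rad]
    fin_cases l
    · simp [sq_nonneg]
    · simp [sq_nonneg]
  have h2 : |R i| ≤ ∑ i, |R i| :=
    Finset.single_le_sum (f := fun i => |R i|) (fun i _ => abs_nonneg (R i)) (Finset.mem_univ i)
  have h3 := le_abs_self (R i)
  nlinarith

theorem hasCompactSupport_cutProd {X : Λ → ℝ → ℝ} (hX : ∀ i, IsTest (X i)) :
    HasCompactSupport fun φ => (cutProd X φ : Grassmann (Λ × Fin 2)) := by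
  obtain ⟨r, hr⟩ := exists_radius hX
  refine HasCompactSupport.intro (isCompact_closedBall 0 r) fun φ hφ => ?_
  rw [Metric.mem_closedBall, dist_zero_right, not_le] at hφ
  obtain ⟨i, h0, h1⟩ := hr φ hφ
  rw [cutProd, Finset.prod_eq_zero (Finset.mem_univ i), ZeroMemClass.coe_zero]
  simp [cut, h0, h1]

/-- Integration of the first pair of odd variables, followed by the degree-`0` part. -/
def berezinBody (Λ : Type*) [Fintype Λ] : Grassmann (Λ × Fin 2) →ₗ[ℝ] ℝ :=
  (ExteriorAlgebra.algebraMapInv).toLinearMap ∘ₗ berezin (Finset.univ ×ˢ {0})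

theorem berezinBody_apply (x : Grassmann (Λ × Fin 2)) :
    berezinBody Λ x = body (berezin (Finset.univ ×ˢ {0}) x) := rfl

theorem integral_fderiv_eq_zero {u : (Λ → Fin 2 → ℝ) → ℝ} (hu : ContDiff ℝ ∞ u)
    (hc : HasCompactSupport u) (v : Λ → Fin 2 → ℝ) : ∫ φ, fderiv ℝ u φ v = 0 := by
  -- Integration by parts against the constant function `1`.
  have h := integral_mul_fderiv_eq_neg_fderiv_mul_of_integrable (μ := volume) (𝕜 := ℝ)
    (f := fun _ : Λ → Fin 2 → ℝ => (1 : ℝ)) (g := u) (v := v) (by simp)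
    (by
      simp only [one_mul]
      exact ((hu.continuous_fderiv (by simp)).clm_apply
        continuous_const).integrable_of_hasCompactSupport (hc.fderiv_apply ℝ v))
    (by simpa using hu.continuous.integrable_of_hasCompactSupport hc)
    (by simp) (fun x _ => ContDiff.diffAt hu)
  simpa using h

/-- Stokes' theorem for `Q`: the terms with `∂_φ` are total derivatives of compactly supported
functions, and those with fermionic derivatives are killed by the Berezin integration. -/
theorem integral_berezinBody_susy {g : Form Λ 2 2} (hg : ContDiff ℝ ∞ g)
    (hc : HasCompactSupport g) : ∫ φ, berezinBody Λ (susy g φ) = 0 := by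
  have hz : ∀ (i : Λ) (t : (Λ × Fin 2) ⊕ (Λ × Fin 2)) (x : Grassmann (Λ × Fin 2)),
      t = Sum.inl (i, 0) ∨ t = Sum.inr (i, 0) → berezinBody Λ (fermDeriv t x) = 0 := by
    intro i t x ht
    rw [berezinBody_apply, berezin_fermDeriv_of_mem (k := (i, 0)) (by simp) t ht, body_zero]
  have hL : ∀ a : Grassmann (Λ × Fin 2), ContDiff ℝ ∞ fun φ => berezinBody Λ (a * g φ) := fun a =>
    contDiff_linear (berezinBody Λ ∘ₗ LinearMap.mulLeft ℝ a) hg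
  have hLc : ∀ a : Grassmann (Λ × Fin 2), HasCompactSupport fun φ => berezinBody Λ (a * g φ) :=
    fun a => hc.comp_left (g := fun x => berezinBody Λ (a * x)) (by simp)
  have hd : ∀ (a : Grassmann (Λ × Fin 2)) φ v, berezinBody Λ (a * fderiv ℝ g φ v) =
      fderiv ℝ (fun φ => berezinBody Λ (a * g φ)) φ v := fun a φ v =>
    (fderiv_linear (berezinBody Λ ∘ₗ LinearMap.mulLeft ℝ a) (ContDiff.diffAt hg) v).symm
  have hint : ∀ (a : Grassmann (Λ × Fin 2)) v,
      Integrable fun φ => fderiv ℝ (fun φ => berezinBody Λ (a * g φ)) φ v := fun a v =>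
    (((hL a).continuous_fderiv (by simp)).clm_apply
      continuous_const).integrable_of_hasCompactSupport ((hLc a).fderiv_apply ℝ v)
  simp only [susy, map_sum, map_add, map_sub, map_smul, hd, hz _ _ _ (Or.inl rfl),
    hz _ _ _ (Or.inr rfl), smul_zero, sub_zero, add_zero]
  rw [integral_finsetSum _ fun i _ => Integrable.fun_add (hint _ _) (hint _ _)]
  refine Finset.sum_eq_zero fun i _ => ?_
  rw [integral_add (hint _ _) (hint _ _), integral_fderiv_eq_zero (hL _) (hLc _),
    integral_fderiv_eq_zero (hL _) (hLc _), add_zero]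

theorem integrable_berezinBody_cutProd {X : Λ → ℝ → ℝ} (hX : ∀ i, IsTest (X i)) {f : Form Λ 2 2}
    (hf : ContDiff ℝ ∞ f) :
    Integrable fun φ => berezinBody Λ ((cutProd X φ : Grassmann (Λ × Fin 2)) * f φ) := by
  refine Continuous.integrable_of_hasCompactSupport ?_ ?_
  · exact (contDiff_linear (berezinBody Λ) ((isSusy_prod_cut hX Finset.univ).1.mul hf)).continuous
  · have h := (hasCompactSupport_cutProd hX).mul_right (f' := f)
    exact h.comp_left (g := fun x => berezinBody Λ x) (map_zero _)

/-- The difference of the integrands is `Q (pot i * g)`, where `g` is `f` times the cutoff product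
with the Hadamard quotient `θ` at site `i`; `g` is closed and compactly supported. -/
theorem integral_cutProd_update [DecidableEq Λ] {X : Λ → ℝ → ℝ} (hX : ∀ i, IsTest (X i))
    {χ χ' : ℝ → ℝ} (hχ : IsCutoff χ) (hχ' : IsCutoff χ') {f : Form Λ 2 2} (hf : ContDiff ℝ ∞ f)
    (hf0 : ∀ φ, susy f φ = 0) (i : Λ) :
    ∫ φ, berezinBody Λ ((cutProd (Function.update X i χ) φ : Grassmann (Λ × Fin 2)) * f φ) =
      ∫ φ, berezinBody Λ ((cutProd (Function.update X i χ') φ : Grassmann (Λ × Fin 2)) * f φ) := by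
  obtain ⟨θ, hθ, hsub⟩ := hχ.exists_sub_eq_mul hχ'
  have hupd : ∀ {ψ : ℝ → ℝ}, IsTest ψ → ∀ j, IsTest (Function.update X i ψ j) := by
    intro ψ hψ j
    rcases eq_or_ne j i with rfl | hj
    · simpa using hψ
    · simpa [hj] using hX j
  rw [← sub_eq_zero, ← integral_sub (integrable_berezinBody_cutProd (hupd hχ.toIsTest) hf)
    (integrable_berezinBody_cutProd (hupd hχ'.toIsTest) hf)]
  have hP : IsSusy fun φ => (cutProd (Function.update X i θ) φ : Grassmann (Λ × Fin 2)) :=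
    isSusy_prod_cut (hupd hθ) Finset.univ
  set g : Form Λ 2 2 := fun φ =>
    (cutProd (Function.update X i θ) φ : Grassmann (Λ × Fin 2)) * f φ with hg
  have hgd : ContDiff ℝ ∞ g := hP.1.mul hf
  have hg0 : ∀ φ, susy g φ = 0 := fun φ => by
    rw [hg, susy_mul (hP.2 φ) (ContDiff.diffAt hP.1) (ContDiff.diffAt hf), hf0, mul_zero, add_zero]
    exact mul_eq_zero_of_left (hP.3 φ) _
  have hgc : HasCompactSupport fun φ => pot i φ * g φ :=
    ((hasCompactSupport_cutProd (hupd hθ)).mul_right (f' := f)).mul_left (f := pot i)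
  rw [← integral_berezinBody_susy ((contDiff_pot i).mul hgd) hgc]
  congr 1
  funext φ
  rw [← map_sub, susy_pot_mul i hgd, hg0, mul_zero, sub_zero, ← sub_mul, hg]
  simp only [cutProd_update, MulMemClass.coe_mul]
  rw [← sub_mul, cut_sub_cut hχ.toIsTest hχ'.toIsTest hθ hsub, mul_assoc, mul_assoc, mul_assoc]

theorem integral_cutProd_eq {X Y : Λ → ℝ → ℝ} (hX : ∀ i, IsCutoff (X i))
    (hY : ∀ i, IsCutoff (Y i)) {f : Form Λ 2 2} (hf : ContDiff ℝ ∞ f)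
    (hf0 : ∀ φ, susy f φ = 0) :
    ∫ φ, berezinBody Λ ((cutProd X φ : Grassmann (Λ × Fin 2)) * f φ) =
      ∫ φ, berezinBody Λ ((cutProd Y φ : Grassmann (Λ × Fin 2)) * f φ) := by
  classical
  -- The cutoffs are exchanged one site at a time.
  have key : ∀ s : Finset Λ,
      ∫ φ, berezinBody Λ ((cutProd (s.piecewise Y X) φ : Grassmann (Λ × Fin 2)) * f φ) =
      ∫ φ, berezinBody Λ ((cutProd X φ : Grassmann (Λ × Fin 2)) * f φ) := by
    intro s
    induction s using Finset.induction_on with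
    | empty => simp
    | insert i s hi ih =>
      rw [← ih, Finset.piecewise_insert]
      have h : s.piecewise Y X = Function.update (s.piecewise Y X) i (X i) := by
        rw [eq_comm, Function.update_eq_self_iff, Finset.piecewise_eq_of_notMem _ _ _ hi]
      conv_rhs => rw [h]
      refine integral_cutProd_update (fun j => ?_) (hY i) (hX i) hf hf0 i
      by_cases hj : j ∈ s
      · simpa [hj] using (hY j).toIsTest
      · simpa [hj] using (hX j).toIsTest
  have := key Finset.univ
  rw [Finset.piecewise_univ] at this
  exact this.symm

end Localization

section Limits

open Filter Topology

variable {Λ : Type*} [Fintype Λ]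

/-! ### The radial integral -/

/-- In polar coordinates the radial integrand is the derivative of `-χ(r^2)`, so it integrates to `χ
0 = 1`; the angle contributes `2π`. -/
theorem integral_radial {χ : ℝ → ℝ} (hχ : IsCutoff χ) :
    ∫ x : Fin 2 → ℝ, -2 * deriv χ (x 0 ^ 2 + x 1 ^ 2) = 2 * Real.pi := by
  have h1 : ∫ x : Fin 2 → ℝ, -2 * deriv χ (x 0 ^ 2 + x 1 ^ 2) =
      ∫ p : ℝ × ℝ, -2 * deriv χ (p.1 ^ 2 + p.2 ^ 2) :=
    (volume_preserving_finTwoArrow ℝ).integral_comp'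
      (g := fun p : ℝ × ℝ => -2 * deriv χ (p.1 ^ 2 + p.2 ^ 2))
  have h2 : ∫ r in Set.Ioi (0 : ℝ), r * (-2 * deriv χ (r ^ 2)) = 1 := by
    have hd : ∀ r : ℝ, HasDerivAt (fun r => -χ (r ^ 2)) (r * (-2 * deriv χ (r ^ 2))) r := by
      intro r
      have h := ((ContDiff.diffAt hχ.contDiff (x := r ^ 2)).hasDerivAt.comp r
        (hasDerivAt_pow 2 r)).neg
      refine HasDerivAt.congr_deriv h ?_
      push_cast
      ring
    obtain ⟨R, hR⟩ := hχ.toIsTest.exists_zero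
    have hz : ∀ r : ℝ, 1 + |R| < |r| → R < r ^ 2 := by
      intro r hr
      have h3 := le_abs_self R
      have h4 := abs_nonneg R
      rw [← sq_abs]
      nlinarith
    have hsupp : HasCompactSupport fun r : ℝ => r * (-2 * deriv χ (r ^ 2)) := by
      refine HasCompactSupport.intro (isCompact_closedBall 0 (1 + |R|)) fun r hr => ?_
      rw [Metric.mem_closedBall, dist_zero_right, not_le] at hr
      rw [(hR _ (hz r hr)).2]
      simp
    have hcont : Continuous fun r : ℝ => r * (-2 * deriv χ (r ^ 2)) := by
      have := hχ.toIsTest.continuous_deriv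
      fun_prop
    have hlim : Tendsto (fun r : ℝ => -χ (r ^ 2)) atTop (𝓝 0) := by
      refine tendsto_const_nhds.congr' ?_
      filter_upwards [eventually_gt_atTop (1 + |R|)] with r hr
      rw [(hR _ (hz r (hr.trans_le (le_abs_self r)))).1, neg_zero]
    rw [integral_Ioi_of_hasDerivAt_of_tendsto' (fun r _ => hd r)
      (hcont.integrable_of_hasCompactSupport hsupp).integrableOn hlim]
    simp [hχ.zero]
  rw [h1, ← integral_comp_polarCoord_symm]
  have h3 : ∀ p : ℝ × ℝ, p.1 • (-2 * deriv χ ((polarCoord.symm p).1 ^ 2 +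
      (polarCoord.symm p).2 ^ 2)) = (p.1 * (-2 * deriv χ (p.1 ^ 2))) *
        (fun _ : ℝ => (1 : ℝ)) p.2 := by
    intro p
    rw [polarCoord_symm_apply]
    have : (p.1 * Real.cos p.2) ^ 2 + (p.1 * Real.sin p.2) ^ 2 = p.1 ^ 2 := by
      rw [mul_pow, mul_pow, ← mul_add, Real.cos_sq_add_sin_sq, mul_one]
    simp only [this, smul_eq_mul, mul_one]
  simp only [h3]
  rw [polarCoord_target, Measure.volume_eq_prod, setIntegral_prod_mul
    (fun r : ℝ => r * (-2 * deriv χ (r ^ 2))) (fun _ : ℝ => (1 : ℝ)), h2]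
  simp [Real.pi_pos.le]
  ring

/-! ### Expansion of the cutoff form -/

/-- The coefficient of `∏_{i ∈ S} ξ_i η_i` in the cutoff form. -/
def cutWeight (χ : ℝ → ℝ) (S : Finset Λ) (φ : Λ → Fin 2 → ℝ) : ℝ :=
  open Classical in
  (∏ i ∈ S, -2 * deriv χ (rad i φ)) * ∏ i ∈ Finset.univ \ S, χ (rad i φ)

/-- The functional `x ↦ berezinBody (∏_{i ∈ S} ξ_i η_i x)`. -/
def partialBerezin (S : Finset Λ) : Grassmann (Λ × Fin 2) →ₗ[ℝ] ℝ :=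
  berezinBody Λ ∘ₗ LinearMap.mulLeft ℝ
    ((∏ i ∈ S, xiEta (i, 0) : evenPart (Λ × Fin 2)) : Grassmann (Λ × Fin 2))

theorem partialBerezin_univ (x : Grassmann (Λ × Fin 2)) :
    partialBerezin Finset.univ x = body x := by
  have h := body_berezin_prod_mul (Finset.univ ×ˢ {(0 : Fin 2)} : Finset (Λ × Fin 2)) x
  rw [Finset.prod_product] at h
  simpa [partialBerezin, berezinBody_apply] using h

/-- The product over sites is expanded, with `S` the set of sites where the `ξ_i η_i` term is
chosen. -/
theorem berezinBody_cutProd_mul (χ : ℝ → ℝ) (φ : Λ → Fin 2 → ℝ) (x : Grassmann (Λ × Fin 2)) :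
    berezinBody Λ ((cutProd (fun _ => χ) φ : Grassmann (Λ × Fin 2)) * x) =
      ∑ S : Finset Λ, cutWeight χ S φ * partialBerezin S x := by
  classical
  have h : cutProd (fun _ => χ) φ = ∑ S : Finset Λ, cutWeight χ S φ • ∏ i ∈ S, xiEta (i, 0) := by
    unfold cutProd cut
    rw [Finset.prod_add, Finset.powerset_univ]
    refine Finset.sum_congr rfl fun S _ => ?_
    rw [Finset.prod_smul, Finset.prod_smul, Finset.prod_const_one, smul_mul_smul_comm, mul_one]
    unfold cutWeight
    congr!
  rw [h, AddSubmonoidClass.coe_finsetSum, Finset.sum_mul, map_sum]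
  refine Finset.sum_congr rfl fun S _ => ?_
  rw [partialBerezin, LinearMap.comp_apply, LinearMap.mulLeft_apply,
    ← smul_eq_mul (a := cutWeight χ S φ),
    ← map_smul, ← smul_mul_assoc]
  rfl

theorem continuous_cutWeight {χ : ℝ → ℝ} (hχ : IsTest χ) (S : Finset Λ) :
    Continuous (cutWeight χ S) := by
  have h1 := hχ.continuous_deriv
  have h2 := hχ.contDiff.continuous
  have h3 : ∀ i : Λ, Continuous (rad i) := fun i => (contDiff_rad i).continuous
  unfold cutWeight
  fun_prop

theorem exists_cutWeight_eq_zero {χ : ℝ → ℝ} (hχ : IsTest χ) :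
    ∃ r : ℝ, ∀ (φ : Λ → Fin 2 → ℝ) (S : Finset Λ), r < ‖φ‖ → cutWeight χ S φ = 0 := by
  classical
  obtain ⟨r, hr⟩ := exists_radius (X := fun _ : Λ => χ) fun _ => hχ
  refine ⟨r, fun φ S hφ => ?_⟩
  obtain ⟨i, h0, h1⟩ := hr φ hφ
  unfold cutWeight
  by_cases hi : i ∈ S
  · rw [Finset.prod_eq_zero hi (by rw [h1, mul_zero]), zero_mul]
  · rw [Finset.prod_eq_zero (i := i) (s := _ \ S) (by simp [hi]) h0, mul_zero]

theorem exists_cutWeight_bound {χ : ℝ → ℝ} (hχ : IsTest χ) :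
    ∃ M : ℝ, ∀ a : ℝ, 0 < a → a ≤ 1 → ∀ (S : Finset Λ) φ,
      |cutWeight (fun x => χ (a * x)) S φ| ≤ M := by
  classical
  obtain ⟨C, hC⟩ := hχ.compact.exists_bound_of_continuous hχ.contDiff.continuous
  obtain ⟨D, hD⟩ := hχ.compact.deriv.exists_bound_of_continuous hχ.continuous_deriv
  -- The `1` makes powers of `B` monotone in the exponent; `2 * D` bounds `-2 χ'`, and rescaling
  -- multiplies the derivative by `a ≤ 1`.
  set B := max 1 (max C (2 * D)) with hB
  have hB1 : 1 ≤ B := le_max_left _ _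
  refine ⟨B ^ Fintype.card Λ * B ^ Fintype.card Λ, fun a ha ha1 S φ => ?_⟩
  unfold cutWeight
  rw [abs_mul, Finset.abs_prod, Finset.abs_prod]
  have hpow : ∀ (T : Finset Λ) (u : Λ → ℝ), (∀ i, |u i| ≤ B) →
      ∏ i ∈ T, |u i| ≤ B ^ Fintype.card Λ := by
    intro T u hu
    calc ∏ i ∈ T, |u i| ≤ ∏ _i ∈ T, B :=
          Finset.prod_le_prod (fun i _ => abs_nonneg _) fun i _ => hu i
      _ = B ^ T.card := by simp
      _ ≤ B ^ Fintype.card Λ := pow_le_pow_right₀ hB1 (Finset.card_le_univ T)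
  refine mul_le_mul (hpow _ _ fun i => ?_) (hpow _ _ fun i => ?_)
    (Finset.prod_nonneg fun i _ => abs_nonneg _) (by positivity)
  · have hd : deriv (fun x => χ (a * x)) (rad i φ) = a * deriv χ (a * rad i φ) :=
      deriv_comp_mul_left a χ _
    rw [hd, abs_mul, abs_mul, abs_of_pos ha]
    have h1 := hD (a * rad i φ)
    rw [Real.norm_eq_abs] at h1
    have h2 : 2 * D ≤ B := (le_max_right _ _).trans (le_max_right _ _)
    have h3 := abs_nonneg (deriv χ (a * rad i φ))
    rw [show |(-2 : ℝ)| = 2 by norm_num]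
    nlinarith
  · exact (hC _).trans ((le_max_left _ _).trans (le_max_right _ _))

/-- Each differentiated cutoff contributes `t^2`. Against the Jacobian `t^(-2 |Λ|)` of the rescaling
only the term with `S` equal to all of `Λ` is balanced. -/
theorem cutWeight_mul_eq {χ : ℝ → ℝ} {t : ℝ} (ht : t ≠ 0) (S : Finset Λ) (φ : Λ → Fin 2 → ℝ) :
    cutWeight (fun x => χ (t ^ 2 * x)) S (t⁻¹ • φ) = (t ^ 2) ^ S.card * cutWeight χ S φ := by
  classical
  have hr : ∀ i, t ^ 2 * rad i (t⁻¹ • φ) = rad i φ := by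
    intro i
    simp only [rad, Pi.smul_apply, smul_eq_mul]
    field_simp
  have hd : ∀ i, deriv (fun x => χ (t ^ 2 * x)) (rad i (t⁻¹ • φ)) = t ^ 2 * deriv χ (rad i φ) := by
    intro i
    rw [deriv_comp_mul_left (t ^ 2) χ, hr, smul_eq_mul]
  unfold cutWeight
  simp only [hr, hd]
  rw [← mul_assoc, ← Finset.prod_const, ← Finset.prod_mul_distrib]
  congr 1
  refine Finset.prod_congr rfl fun i _ => by ring

/-! ### The localization formula -/

/-- A small factor in the argument means a wide cutoff, which at each fixed `φ` is eventually the
form `1`. The dominating function uses integrability of every functional `partialBerezin S` of `f`,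
not only of the top coefficient. -/
theorem tendsto_integral_cut_small {χ : ℝ → ℝ} (hχ : IsCutoff χ) {f : Form Λ 2 2}
    (hf : ContDiff ℝ ∞ f) (hint : ∀ c : Module.Dual ℝ (Grassmann (Λ × Fin 2)),
      Integrable fun φ => c (f φ)) :
    Tendsto (fun n : ℕ => ∫ φ, berezinBody Λ ((cutProd
      (fun _ => fun x => χ (((n : ℝ) + 1)⁻¹ * x)) φ : Grassmann (Λ × Fin 2)) * f φ)) atTop
      (𝓝 (∫ φ, berezinBody Λ (f φ))) := by
  have hn : ∀ n : ℕ, 0 < ((n : ℝ) + 1)⁻¹ := fun n => by positivity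
  have hn1 : ∀ n : ℕ, ((n : ℝ) + 1)⁻¹ ≤ 1 := fun n =>
    inv_le_one_of_one_le₀ (by linarith [(Nat.cast_nonneg n : (0 : ℝ) ≤ n)])
  obtain ⟨M, hM⟩ := exists_cutWeight_bound (Λ := Λ) hχ.toIsTest
  refine tendsto_integral_of_dominated_convergence
    (fun φ => ∑ S : Finset Λ, M * |partialBerezin S (f φ)|) (fun n => ?_) ?_ (fun n => ?_) ?_
  · exact (integrable_berezinBody_cutProd
      (fun _ => (hχ.comp_mul_left (hn n)).toIsTest) hf).aestronglyMeasurable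
  · exact integrable_finsetSum _ fun S _ => ((hint (partialBerezin S)).abs).const_mul M
  · refine Eventually.of_forall fun φ => ?_
    rw [berezinBody_cutProd_mul, Real.norm_eq_abs]
    refine (Finset.abs_sum_le_sum_abs _ _).trans (Finset.sum_le_sum fun S _ => ?_)
    rw [abs_mul]
    exact mul_le_mul_of_nonneg_right (hM _ (hn n) (hn1 n) S φ) (abs_nonneg _)
  · refine Eventually.of_forall fun φ => ?_
    refine tendsto_const_nhds.congr' ?_
    have hlim : ∀ i : Λ, Tendsto (fun n : ℕ => ((n : ℝ) + 1)⁻¹ * rad i φ) atTop (𝓝 0) := by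
      intro i
      have := (tendsto_one_div_add_atTop_nhds_zero_nat (𝕜 := ℝ)).mul_const (rad i φ)
      simpa using this
    have hev : ∀ᶠ n : ℕ in atTop, ∀ i : Λ, χ =ᶠ[𝓝 (((n : ℝ) + 1)⁻¹ * rad i φ)] 1 :=
      eventually_all.2 fun i => (hlim i).eventually hχ.eventually_one.eventuallyEq_nhds
    filter_upwards [hev] with n hn'
    have : cutProd (fun _ => fun x => χ (((n : ℝ) + 1)⁻¹ * x)) φ = 1 := by
      refine Finset.prod_eq_one fun i _ => ?_
      have h0 : χ (((n : ℝ) + 1)⁻¹ * rad i φ) = 1 := (hn' i).self_of_nhds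
      have h1 : deriv χ (((n : ℝ) + 1)⁻¹ * rad i φ) = 0 := by
        rw [(hn' i).deriv_eq]
        exact deriv_const _ _
      unfold cut
      beta_reduce
      rw [deriv_comp_mul_left (((n : ℝ) + 1)⁻¹) χ, h0, h1]
      simp
    rw [this, OneMemClass.coe_one, one_mul]

/-- After `φ` is rescaled by `n + 1`, the term of `S` carries `(n + 1)^(-2(|Λ| - |S|))` and `f` is
evaluated ever closer to `0`. Only the full set survives, and its weight integrates to `2π` per
site. -/
theorem tendsto_integral_cut_large {χ : ℝ → ℝ} (hχ : IsCutoff χ) {f : Form Λ 2 2}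
    (hf : ContDiff ℝ ∞ f) :
    Tendsto (fun n : ℕ => ∫ φ, berezinBody Λ ((cutProd
      (fun _ => fun x => χ (((n : ℝ) + 1) ^ 2 * x)) φ : Grassmann (Λ × Fin 2)) * f φ)) atTop
      (𝓝 ((2 * Real.pi) ^ Fintype.card Λ * body (f 0))) := by
  classical
  set N := Fintype.card Λ with hN
  have hn0 : ∀ n : ℕ, (n : ℝ) + 1 ≠ 0 := fun n => by positivity
  have hn1 : ∀ n : ℕ, 1 ≤ (n : ℝ) + 1 := fun n => by
    linarith [(Nat.cast_nonneg n : (0 : ℝ) ≤ n)]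
  have hdim : Module.finrank ℝ (Λ → Fin 2 → ℝ) = 2 * N := by
    rw [Module.finrank_pi_fintype]
    simp [hN, mul_comm]
  have hcard : ∀ S : Finset Λ, S.card ≤ N := fun S => Finset.card_le_univ S
  have hscale : ∀ n : ℕ, ∫ φ, berezinBody Λ ((cutProd
      (fun _ => fun x => χ (((n : ℝ) + 1) ^ 2 * x)) φ : Grassmann (Λ × Fin 2)) * f φ) =
      ∫ φ, ∑ S : Finset Λ, ((((n : ℝ) + 1) ^ 2) ^ (N - S.card))⁻¹ *
        (cutWeight χ S φ * partialBerezin S (f (((n : ℝ) + 1)⁻¹ • φ))) := by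
    intro n
    have h := Measure.integral_comp_inv_smul_of_nonneg volume (fun φ : Λ → Fin 2 → ℝ =>
      berezinBody Λ ((cutProd (fun _ => fun x => χ (((n : ℝ) + 1) ^ 2 * x)) φ :
        Grassmann (Λ × Fin 2)) * f φ)) ((zero_le_one.trans (hn1 n)))
    rw [hdim, smul_eq_mul] at h
    have hne : ((n : ℝ) + 1) ^ (2 * N) ≠ 0 := pow_ne_zero _ (hn0 n)
    -- The real dimension `2 |Λ|` gives the Jacobian exponent, split below as `2(|Λ| - |S|) + 2|S|`.
    rw [← inv_mul_eq_iff_eq_mul₀ hne] at h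
    rw [← h, ← integral_const_mul]
    congr 1
    funext φ
    rw [berezinBody_cutProd_mul, Finset.mul_sum]
    refine Finset.sum_congr rfl fun S _ => ?_
    rw [cutWeight_mul_eq (hn0 n)]
    have e : ((n : ℝ) + 1) ^ (2 * N) =
        (((n : ℝ) + 1) ^ 2) ^ (N - S.card) * (((n : ℝ) + 1) ^ 2) ^ S.card := by
      rw [← pow_add, Nat.sub_add_cancel (hcard S), pow_mul]
    rw [e]
    have := hn0 n
    field_simp
  simp only [hscale]
  obtain ⟨r, hr⟩ := exists_cutWeight_eq_zero (Λ := Λ) hχ.toIsTest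
  have hLc : ∀ S : Finset Λ, Continuous fun φ => partialBerezin S (f φ) := fun S =>
    (contDiff_linear (partialBerezin S) hf).continuous
  choose C hC using fun S : Finset Λ =>
    (isCompact_closedBall (0 : Λ → Fin 2 → ℝ) r).exists_bound_of_continuousOn (hLc S).continuousOn
  have hlimit : (2 * Real.pi) ^ N * body (f 0) = ∫ φ, ∑ S : Finset Λ,
      (if S = Finset.univ then (1 : ℝ) else 0) *
        (cutWeight χ S φ * partialBerezin S (f 0)) := by
    simp only [ite_mul, one_mul, zero_mul, Finset.sum_ite_eq', Finset.mem_univ, if_true]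
    rw [integral_mul_const, partialBerezin_univ]
    congr 1
    have : ∀ φ : Λ → Fin 2 → ℝ, cutWeight χ Finset.univ φ =
        ∏ i, (fun x : Fin 2 → ℝ => -2 * deriv χ (x 0 ^ 2 + x 1 ^ 2)) (φ i) := fun φ => by
      simp [cutWeight, rad]
    simp only [this]
    rw [integral_fintype_prod_volume_eq_pow
      (fun x : Fin 2 → ℝ => -2 * deriv χ (x 0 ^ 2 + x 1 ^ 2)), integral_radial hχ]
  rw [hlimit]
  have hmem : ∀ (n : ℕ) (φ : Λ → Fin 2 → ℝ), ‖φ‖ ≤ r → ((n : ℝ) + 1)⁻¹ • φ ∈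
      Metric.closedBall (0 : Λ → Fin 2 → ℝ) r := by
    intro n φ hφ
    rw [Metric.mem_closedBall, dist_zero_right, norm_smul, norm_inv, Real.norm_eq_abs,
      abs_of_nonneg (zero_le_one.trans (hn1 n))]
    exact (mul_le_of_le_one_left (norm_nonneg _) (inv_le_one_of_one_le₀ (hn1 n))).trans hφ
  refine tendsto_integral_of_dominated_convergence
    (fun φ => ∑ S : Finset Λ, |cutWeight χ S φ| * C S) (fun n => ?_) ?_ (fun n => ?_) ?_
  · refine Continuous.aestronglyMeasurable (continuous_finsetSum _ fun S _ => ?_)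
    exact continuous_const.mul ((continuous_cutWeight hχ.toIsTest S).mul
      ((hLc S).comp (continuous_const_smul _)))
  · refine integrable_finsetSum _ fun S _ => Integrable.mul_const (Integrable.abs ?_) _
    refine (continuous_cutWeight hχ.toIsTest S).integrable_of_hasCompactSupport
      (HasCompactSupport.intro (isCompact_closedBall 0 r) fun φ hφ => hr φ S ?_)
    rwa [Metric.mem_closedBall, dist_zero_right, not_le] at hφ
  · refine Eventually.of_forall fun φ => ?_
    rw [Real.norm_eq_abs]
    refine (Finset.abs_sum_le_sum_abs _ _).trans (Finset.sum_le_sum fun S _ => ?_)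
    rcases lt_or_ge r ‖φ‖ with hφ | hφ
    · simp [hr φ S hφ]
    · rw [abs_mul, abs_mul]
      have h1 : |((((n : ℝ) + 1) ^ 2) ^ (N - S.card))⁻¹| ≤ 1 := by
        rw [abs_of_nonneg (by positivity)]
        exact inv_le_one_of_one_le₀ (one_le_pow₀ (one_le_pow₀ (hn1 n)))
      refine (mul_le_of_le_one_left (by positivity) h1).trans ?_
      exact mul_le_mul_of_nonneg_left (hC S _ (hmem n φ hφ)) (abs_nonneg _)
  · refine Eventually.of_forall fun φ => ?_
    refine tendsto_finsetSum _ fun S _ => Tendsto.mul ?_ (Tendsto.mul tendsto_const_nhds ?_)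
    · split_ifs with hS
      · subst hS
        simp [hN]
      · have hlt : 0 < N - S.card := Nat.sub_pos_of_lt
          ((Finset.card_lt_iff_ne_univ S).2 hS)
        have h1 : Tendsto (fun n : ℕ => (n : ℝ) + 1) atTop atTop :=
          tendsto_atTop_add_const_right _ _ tendsto_natCast_atTop_atTop
        exact tendsto_inv_atTop_zero.comp ((tendsto_pow_atTop hlt.ne').comp
          ((tendsto_pow_atTop two_ne_zero).comp h1))
    · have h1 : Tendsto (fun n : ℕ => ((n : ℝ) + 1)⁻¹ • φ) atTop (𝓝 0) := by
        have := (tendsto_one_div_add_atTop_nhds_zero_nat (𝕜 := ℝ)).smul_const φ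
        simpa using this
      exact ((hLc S).tendsto 0).comp h1

/-- **Localization.** The superintegral over `φ` and one pair of odd variables of a supersymmetric
(that is, `Q`-closed) form with integrable coefficients is its degree-`0` part at the origin. -/
theorem integral_berezinBody_eq {f : Form Λ 2 2} (hf : ContDiff ℝ ∞ f) (hf0 : ∀ φ, susy f φ = 0)
    (hint : ∀ c : Module.Dual ℝ (Grassmann (Λ × Fin 2)), Integrable fun φ => c (f φ)) :
    ∫ φ, berezinBody Λ (f φ) = (2 * Real.pi) ^ Fintype.card Λ * body (f 0) := by
  obtain ⟨χ, hχ⟩ := exists_isCutoff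
  refine tendsto_nhds_unique (tendsto_integral_cut_small hχ hf hint) ?_
  -- By independence of the cutoff the wide and narrow sequences agree term by term, so they have
  -- the same limit.
  refine (tendsto_integral_cut_large hχ hf).congr fun n => ?_
  exact integral_cutProd_eq (fun _ => hχ.comp_mul_left (by positivity))
    (fun _ => hχ.comp_mul_left (by positivity)) hf hf0

end Limits

/-! ### Supersymmetry of the model -/

section Model

variable {Λ : Type*} [Fintype Λ]

theorem SuperVec.sub_dot_sub {n m : ℕ} {A : Type*} [Ring A] (u v : SuperVec n m A) :
    (u - v).dot (u - v) = u.dot u - u.dot v - v.dot u + v.dot v := by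
  have h1 : (u - v).phi = u.phi - v.phi := rfl
  have h2 : (u - v).xi = u.xi - v.xi := rfl
  have h3 : (u - v).eta = u.eta - v.eta := rfl
  have h4 : (u - v).z = u.z - v.z := rfl
  simp only [SuperVec.dot, h1, h2, h3, h4, Pi.sub_apply, mul_sub, sub_mul, Finset.sum_sub_distrib]
  abel

/-- The part `∑ φ_i φ_j + ∑ (η_i ξ_j - ξ_i η_j)` of the inner product of two spins. -/
def flatDot (i j : Λ) : Form Λ 2 2 := fun φ =>
  ∑ l, algebraMap ℝ (Grassmann (Λ × Fin 2)) (φ i l) * algebraMap ℝ _ (φ j l) +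
    ∑ l, (eta (i, l) * xi (j, l) - xi (i, l) * eta (j, l))

theorem susy_const_ι (v : ((Λ × Fin 2) ⊕ (Λ × Fin 2)) →₀ ℝ) (φ : Λ → Fin 2 → ℝ) :
    susy (fun _ => ExteriorAlgebra.ι ℝ v) φ =
      (∑ i, (φ i 1 * v (Sum.inl (i, 0)) - φ i 0 * v (Sum.inr (i, 0)))) • 1 := by
  have h := susy_ι_mul (φ := φ) v (g := fun _ => 1) (by fun_prop)
  have e1 : susy (fun _ => (1 : Grassmann (Λ × Fin 2))) φ = 0 := by
    simpa using (IsSusy.const (Λ := Λ) 1).3 φ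
  simpa only [mul_one, e1, mul_zero, sub_zero] using h

theorem susy_const_ι_mul_ι (v w : ((Λ × Fin 2) ⊕ (Λ × Fin 2)) →₀ ℝ) (φ : Λ → Fin 2 → ℝ) :
    susy (fun _ => ExteriorAlgebra.ι ℝ v * ExteriorAlgebra.ι ℝ w) φ =
      (∑ i, (φ i 1 * v (Sum.inl (i, 0)) - φ i 0 * v (Sum.inr (i, 0)))) • ExteriorAlgebra.ι ℝ w
      - (∑ i, (φ i 1 * w (Sum.inl (i, 0)) - φ i 0 * w (Sum.inr (i, 0)))) •
        ExteriorAlgebra.ι ℝ v := by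
  rw [susy_ι_mul (φ := φ) v (g := fun _ => ExteriorAlgebra.ι ℝ w) (by fun_prop), susy_const_ι,
    mul_smul_comm, mul_one]

/-- The bosonic part produces `φ_i^1 ξ_j + φ_j^1 ξ_i + φ_i^2 η_j + φ_j^2 η_i`, and the first pair of
odd variables produces its negative. The second pair is constant for `Q`. -/
theorem isSusy_flatDot (i j : Λ) : IsSusy (flatDot i j) := by
  classical
  set r : (Λ → Fin 2 → ℝ) → ℝ := fun φ => φ i 0 * φ j 0 + φ i 1 * φ j 1 with hr
  have hrd : ContDiff ℝ ∞ r := ((contDiff_coord i 0).mul (contDiff_coord j 0)).add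
    ((contDiff_coord i 1).mul (contDiff_coord j 1))
  -- The Boolean separates the two kinds of odd monomials, so that each is a scalar times a product
  -- of two generators.
  have e : flatDot i j = fun φ => algebraMap ℝ (Grassmann (Λ × Fin 2)) (r φ) +
      ∑ t : Fin 2 × Bool, (if t.2 then (1 : ℝ) else -1) •
        (if t.2 then eta (i, t.1) * xi (j, t.1) else xi (i, t.1) * eta (j, t.1)) := by
    funext φ
    simp only [flatDot, hr, Fin.sum_univ_two, Fintype.sum_prod_type, Fintype.sum_bool]
    simp [sub_eq_add_neg]
  rw [e]
  refine ⟨(contDiff_algebraMap hrd).add contDiff_const, fun φ => add_mem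
    (Subalgebra.algebraMap_mem _ _) (sum_mem fun t _ => Subalgebra.smul_mem _ ?_ _), fun φ => ?_⟩
  · split_ifs
    · exact eta_mul_xi_mem_evenPart _ _
    · exact xi_mul_eta_mem_evenPart _ _
  rw [susy_add (ContDiff.diffAt (contDiff_algebraMap hrd)) (by fun_prop),
    susy_algebraMap (ContDiff.diffAt hrd),
    susy_sum Finset.univ (f := fun (t : Fin 2 × Bool) _ => (if t.2 then (1 : ℝ) else -1) •
        (if t.2 then eta (i, t.1) * xi (j, t.1) else xi (i, t.1) * eta (j, t.1)))
      (fun t _ => by fun_prop)]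
  have hodd : oddDiff r φ = φ i 0 • xi (j, 0) + φ j 0 • xi (i, 0) + φ i 1 • eta (j, 0)
      + φ j 1 • eta (i, 0) := by
    have h : ∀ v, fderiv ℝ r φ v =
        φ i 0 * fderiv ℝ (fun φ => φ j 0) φ v + φ j 0 * fderiv ℝ (fun φ => φ i 0) φ v +
        (φ i 1 * fderiv ℝ (fun φ => φ j 1) φ v + φ j 1 * fderiv ℝ (fun φ => φ i 1) φ v) := by
      intro v
      have hd : ∀ (k : Λ) (l : Fin 2), HasFDerivAt (fun φ : Λ → Fin 2 → ℝ => φ k l)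
          (fderiv ℝ (fun φ : Λ → Fin 2 → ℝ => φ k l) φ) φ := fun k l =>
        (ContDiff.diffAt (contDiff_coord k l)).hasFDerivAt
      have hf := (((hd i 0).mul (hd j 0)).add ((hd i 1).mul (hd j 1))).fderiv
      rw [show r = ((fun φ => φ i 0) * fun φ => φ j 0) + (fun φ => φ i 1) * fun φ => φ j 1 from rfl,
        hf]
      simp only [add_apply, smul_apply, smul_eq_mul]
    unfold oddDiff
    simp [h, fderiv_coord, add_smul, Finset.sum_add_distrib]
    abel
  simp only [Fintype.sum_prod_type, Fin.sum_univ_two, Fintype.sum_bool]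
  simp only [if_true, Bool.false_eq_true, if_false, one_smul]
  rw [susy_smul _ (by fun_prop), susy_smul _ (by fun_prop), hodd]
  simp only [xi, eta, susy_const_ι_mul_ι]
  simp [Finsupp.single_apply]
  module

theorem zSq_eq (i : Λ) (φ : Λ → Fin 2 → ℝ) :
    zSq (m := 2) i φ = algebraMap ℝ _ 1 + flatDot i i φ := by
  have h : ∀ l : Fin 2, (-2 : ℝ) • (xi (i, l) * eta (i, l)) =
      (eta (i, l) * xi (i, l) - xi (i, l) * eta (i, l) : Grassmann (Λ × Fin 2)) := by
    intro l
    rw [eta, xi, ι_anticomm (Finsupp.single (Sum.inr (i, l)) 1)]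
    module
  simp only [zSq, flatDot, h, map_add, map_sum, ← map_mul, sq, add_assoc]

theorem isSusy_zSq (i : Λ) : IsSusy (zSq (m := 2) i) := by
  have : zSq (m := 2) i = fun φ => algebraMap ℝ _ 1 + flatDot i i φ := funext (zSq_eq i)
  rw [this]
  exact (IsSusy.const 1).add (isSusy_flatDot i i)

theorem body_zSq_pos {Λ : Type*} {n m : ℕ} (i : Λ) (φ : Λ → Fin n → ℝ) :
    0 < body (zSq (m := m) i φ) := by
  simp only [zSq, body_add, body_algebraMap, body_sum, body_smul, body_mul, body_xi, zero_mul,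
    mul_zero, Finset.sum_const_zero, add_zero]
  positivity

theorem isSusy_zForm (i : Λ) : IsSusy (zForm (m := 2) i) :=
  (isSusy_zSq i).evalOne fun φ => Real.contDiffAt_sqrt (body_zSq_pos i φ).ne'

theorem isSusy_invZ (i : Λ) : IsSusy fun φ => evalOne (fun t => t⁻¹) (zForm (m := 2) i φ) := by
  refine (isSusy_zForm i).evalOne fun φ => contDiffAt_inv ℝ ?_
  rw [zForm, body_evalOne]
  exact (Real.sqrt_pos.2 (body_zSq_pos i φ)).ne'

theorem isSusy_dot (i j : Λ) : IsSusy fun φ => (spin (n := 2) (m := 2) φ i).dot (spin φ j) :=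
  (isSusy_flatDot i j).sub ((isSusy_zForm i).mul (isSusy_zForm j))

theorem isSusy_action (β : Λ → Λ → ℝ) (h : Λ → ℝ) : IsSusy (action (n := 2) (m := 2) β h) := by
  refine IsSusy.add (IsSusy.smul _ (IsSusy.sum _ fun i _ => IsSusy.sum _ fun j _ =>
    IsSusy.smul _ ?_)) (IsSusy.sum _ fun i _ => IsSusy.smul _ ?_)
  · simp only [SuperVec.sub_dot_sub]
    exact (((isSusy_dot i i).sub (isSusy_dot i j)).sub (isSusy_dot j i)).add (isSusy_dot j j)
  · simpa using (isSusy_zForm i).sub (IsSusy.const 1)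

theorem isSusy_gram (k : Option Λ × Option Λ) :
    IsSusy fun φ => gram (n := 2) (m := 2) φ k := by
  rcases k with ⟨_ | i, _ | j⟩
  · simpa [gram] using IsSusy.const (Λ := Λ) (-1)
  · exact isSusy_zForm j
  · exact isSusy_zForm i
  · exact isSusy_dot i j

theorem isSusy_weighted (β : Λ → Λ → ℝ) (h : Λ → ℝ) {F : (Option Λ × Option Λ → ℝ) → ℝ}
    (hF : ContDiff ℝ ∞ F) : IsSusy (weighted β h (observable 2 2 F)) :=
  (IsSusy.evalMany isSusy_gram hF).mul
    ((isSusy_action β h).neg.evalOne fun _ => Real.contDiff_exp.contDiffAt)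

theorem isSusy_prodInvZ : IsSusy (prodInvZ (Λ := Λ) (n := 2) (m := 2)) := by
  classical
  have key : ∀ s : Finset Λ, IsSusy fun φ : Λ → Fin 2 → ℝ =>
      s.noncommProd (fun i => evalOne (fun t => t⁻¹) (zForm (m := 2) i φ))
      (fun i _ j _ _ => commute_evalOne _ _ (commute_evalOne _ _ (commute_zSq φ i j))) := by
    intro s
    induction s using Finset.induction_on with
    | empty =>
      have e := fun φ : Λ → Fin 2 → ℝ => Finset.noncommProd_empty
        (fun i => evalOne (fun t => t⁻¹) (zForm (m := 2) i φ))
        (fun i _ j _ _ => commute_evalOne _ _ (commute_evalOne _ _ (commute_zSq φ i j)))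
      simp only [e]
      simpa using IsSusy.const (Λ := Λ) 1
    | insert i s hi ih =>
      have e := fun φ : Λ → Fin 2 → ℝ => Finset.noncommProd_insert_of_notMem s i
        (fun i => evalOne (fun t => t⁻¹) (zForm (m := 2) i φ))
        (fun i _ j _ _ => commute_evalOne _ _ (commute_evalOne _ _ (commute_zSq φ i j))) hi
      simp only [e]
      exact (isSusy_invZ i).mul ih
  exact key Finset.univ

end Model

/-! ### Restriction to a smaller set of generators -/

section Restriction

variable {ι κ : Type*}

/-- The linear map that restricts coefficient vectors along an embedding. -/
def restrictCoeff (e : κ ↪ ι) : ((ι ⊕ ι) →₀ ℝ) →ₗ[ℝ] ((κ ⊕ κ) →₀ ℝ) :=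
  Finsupp.lcomapDomain (Sum.map e e) (e.injective.sumMap e.injective)

theorem restrictCoeff_apply (e : κ ↪ ι) (v : (ι ⊕ ι) →₀ ℝ) (g : κ ⊕ κ) :
    restrictCoeff e v g = v (Sum.map e e g) := rfl

/-- The homomorphism of Grassmann algebras that identifies the generators in the range of an
embedding with those of the smaller algebra, and kills the others. -/
def restrictHom (e : κ ↪ ι) : Grassmann ι →ₐ[ℝ] Grassmann κ := ExteriorAlgebra.map (restrictCoeff e)

theorem restrictHom_ι (e : κ ↪ ι) (v : (ι ⊕ ι) →₀ ℝ) :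
    restrictHom e (ExteriorAlgebra.ι ℝ v) = ExteriorAlgebra.ι ℝ (restrictCoeff e v) :=
  ExteriorAlgebra.map_apply_ι _ _

theorem restrictHom_xi (e : κ ↪ ι) (k : κ) : restrictHom e (xi (e k)) = xi k := by
  classical
  rw [xi, restrictHom_ι, xi]
  congr 1
  ext (g | g) <;> simp [restrictCoeff_apply, Finsupp.single_apply]

theorem restrictHom_eta (e : κ ↪ ι) (k : κ) : restrictHom e (eta (e k)) = eta k := by
  classical
  rw [eta, restrictHom_ι, eta]
  congr 1
  ext (g | g) <;> simp [restrictCoeff_apply, Finsupp.single_apply]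

theorem restrictHom_xi_of_notMem (e : κ ↪ ι) {i : ι} (hi : ∀ k, e k ≠ i) :
    restrictHom e (xi i) = 0 := by
  classical
  rw [xi, restrictHom_ι, show restrictCoeff e (Finsupp.single (Sum.inl i) 1) = 0 from ?_, map_zero]
  ext (g | g) <;> simp [restrictCoeff_apply, (hi _).symm]

theorem restrictHom_eta_of_notMem (e : κ ↪ ι) {i : ι} (hi : ∀ k, e k ≠ i) :
    restrictHom e (eta i) = 0 := by
  classical
  rw [eta, restrictHom_ι, show restrictCoeff e (Finsupp.single (Sum.inr i) 1) = 0 from ?_, map_zero]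
  ext (g | g) <;> simp [restrictCoeff_apply, (hi _).symm]

theorem body_restrictHom (e : κ ↪ ι) (a : Grassmann ι) : body (restrictHom e a) = body a := by
  have : (ExteriorAlgebra.algebraMapInv (R := ℝ)).comp (restrictHom e) =
      ExteriorAlgebra.algebraMapInv := by
    refine ExteriorAlgebra.hom_ext (LinearMap.ext fun v => ?_)
    change body (restrictHom e (ExteriorAlgebra.ι ℝ v)) = body (ExteriorAlgebra.ι ℝ v)
    rw [restrictHom_ι, body_ι, body_ι]
  exact DFunLike.congr_fun this a

/-- A derivative in a retained generator does not see the discarded ones, so it does not matter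
whether they are set to zero before or after it. -/
theorem restrictHom_fermDeriv (e : κ ↪ ι) (g : κ ⊕ κ) (a : Grassmann ι) :
    restrictHom e (fermDeriv (Sum.map e e g) a) = fermDeriv g (restrictHom e a) := by
  induction a using CliffordAlgebra.left_induction with
  | algebraMap r =>
    have h1 := fermDeriv_algebraMap (Sum.map e e g) r
    have h2 := fermDeriv_algebraMap g r
    rw [h1, map_zero, AlgHom.commutes, h2]
  | add x y hx hy => rw [map_add, map_add, hx, hy, map_add, map_add]
  | ι_mul x v hx =>
    have h1 := fermDeriv_ι_mul (Sum.map e e g) v x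
    have h2 := fermDeriv_ι_mul g (restrictCoeff e v) (restrictHom e x)
    have h3 := restrictHom_ι e v
    unfold ExteriorAlgebra.ι at h1 h2 h3
    rw [h1, map_mul, h3, h2, map_sub, map_smul, map_mul, h3, hx, restrictCoeff_apply]

theorem restrictHom_berezin (e : κ ↪ ι) (S : Finset κ) (a : Grassmann ι) :
    restrictHom e (berezin (S.map e) a) = berezin S (restrictHom e a) := by
  classical
  induction S using Finset.induction_on with
  | empty => simp
  | insert k S hk ih =>
    rw [Finset.map_insert, berezin_insert (by simpa using hk), berezin_insert hk,
      Module.End.mul_apply, Module.End.mul_apply, ← ih]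
    simp only [pairDeriv, Module.End.mul_apply]
    rw [← restrictHom_fermDeriv, ← restrictHom_fermDeriv]
    rfl

end Restriction

/-! ### Restriction to the origin and the second pair of odd variables. -/

section Reduction

variable {Λ : Type*}

/-- The embedding of the indices of the `m = 1` model as the second pair of odd variables of the
`m = 2` model. -/
def secondPair (Λ : Type*) : Λ × Fin 1 ↪ Λ × Fin 2 where
  toFun p := (p.1, 1)
  inj' _ _ h := Prod.ext (Prod.ext_iff.1 h).1 (Subsingleton.elim _ _)

theorem secondPair_apply (p : Λ × Fin 1) : secondPair Λ p = (p.1, 1) := rfl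

theorem secondPair_ne (p : Λ × Fin 1) (i : Λ) : secondPair Λ p ≠ (i, 0) := by
  simp [secondPair_apply]

theorem reduce_xi_one (i : Λ) : restrictHom (secondPair Λ) (xi (i, 1)) = xi (i, 0) :=
  restrictHom_xi (secondPair Λ) (i, 0)

theorem reduce_eta_one (i : Λ) : restrictHom (secondPair Λ) (eta (i, 1)) = eta (i, 0) :=
  restrictHom_eta (secondPair Λ) (i, 0)

theorem reduce_xi_zero (i : Λ) : restrictHom (secondPair Λ) (xi (i, 0)) = 0 :=
  restrictHom_xi_of_notMem _ fun k => secondPair_ne k i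

theorem reduce_eta_zero (i : Λ) : restrictHom (secondPair Λ) (eta (i, 0)) = 0 :=
  restrictHom_eta_of_notMem _ fun k => secondPair_ne k i

/-- At `φ = 0` and with the first pair killed, only `1 - 2 ξ_i η_i` of the second pair remains. The
other reductions follow because the restriction commutes with functions of even elements. -/
theorem reduce_zSq (i : Λ) (φ : Λ → Fin 0 → ℝ) :
    restrictHom (secondPair Λ) (zSq (n := 2) (m := 2) i 0) = zSq i φ := by
  simp [zSq, reduce_xi_one, reduce_eta_one, reduce_xi_zero]

variable [Fintype Λ]

theorem reduce_zForm (i : Λ) (φ : Λ → Fin 0 → ℝ) :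
    restrictHom (secondPair Λ) (zForm (n := 2) (m := 2) i 0) = zForm i φ := by
  rw [zForm, map_evalOne _ (body_restrictHom _), reduce_zSq i φ, zForm]

theorem reduce_dot (i j : Λ) (φ : Λ → Fin 0 → ℝ) :
    restrictHom (secondPair Λ) ((spin (n := 2) (m := 2) 0 i).dot (spin 0 j)) =
      (spin φ i).dot (spin φ j) := by
  simp [SuperVec.dot, spin, reduce_xi_one, reduce_eta_one, reduce_xi_zero, reduce_eta_zero,
    reduce_zForm _ φ]

theorem reduce_gram (k : Option Λ × Option Λ) (φ : Λ → Fin 0 → ℝ) :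
    restrictHom (secondPair Λ) (gram (n := 2) (m := 2) 0 k) = gram φ k := by
  rcases k with ⟨_ | i, _ | j⟩
  · simp [gram]
  · exact reduce_zForm j φ
  · exact reduce_zForm i φ
  · exact reduce_dot i j φ

theorem reduce_observable (F : (Option Λ × Option Λ → ℝ) → ℝ) (φ : Λ → Fin 0 → ℝ) :
    restrictHom (secondPair Λ) (observable 2 2 F 0) = observable 0 1 F φ := by
  rw [observable, map_evalMany _ (body_restrictHom _)]
  simp only [reduce_gram _ φ]
  rfl

theorem reduce_action (β : Λ → Λ → ℝ) (h : Λ → ℝ) (φ : Λ → Fin 0 → ℝ) :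
    restrictHom (secondPair Λ) (action (n := 2) (m := 2) β h 0) = action β h φ := by
  simp only [action, SuperVec.sub_dot_sub, map_add, map_sub, map_smul, map_sum, map_one,
    reduce_dot _ _ φ, reduce_zForm _ φ]

theorem reduce_weighted (β : Λ → Λ → ℝ) (h : Λ → ℝ) (F : (Option Λ × Option Λ → ℝ) → ℝ)
    (φ : Λ → Fin 0 → ℝ) :
    restrictHom (secondPair Λ) (weighted β h (observable 2 2 F) 0) =
      weighted β h (observable 0 1 F) φ := by
  rw [weighted, map_mul, map_evalOne _ (body_restrictHom _), map_neg, reduce_action β h φ,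
    reduce_observable F φ, weighted]

theorem reduce_prodInvZ (φ : Λ → Fin 0 → ℝ) :
    restrictHom (secondPair Λ) (prodInvZ (n := 2) (m := 2) 0) = prodInvZ φ := by
  unfold prodInvZ
  refine (Finset.map_noncommProd Finset.univ
    (fun i => evalOne (fun t => t⁻¹) (zForm (n := 2) (m := 2) i 0)) (fun i _ j _ _ =>
      commute_evalOne _ _ (commute_evalOne _ _ (commute_zSq 0 i j)))
    (restrictHom (secondPair Λ))).trans (Finset.noncommProd_congr rfl (fun i _ => ?_) _)
  rw [map_evalOne _ (body_restrictHom _), reduce_zForm i φ]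

/-- Terms that contain a first-pair generator still contain it after the second pair is integrated
out, so they have no degree-`0` part and may be discarded beforehand. -/
theorem body_berezin_reduce (a : Grassmann (Λ × Fin 2)) :
    body (berezin Finset.univ (restrictHom (secondPair Λ) a)) =
      body (berezin (Finset.univ ×ˢ {1}) a) := by
  have : (Finset.univ : Finset (Λ × Fin 1)).map (secondPair Λ) = Finset.univ ×ˢ {1} := by
    ext ⟨i, l⟩
    fin_cases l <;> simp [secondPair_apply]
  rw [← restrictHom_berezin, body_restrictHom, this]

theorem berezin_univ_eq (a : Grassmann (Λ × Fin 2)) :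
    body (berezin Finset.univ a) = berezinBody Λ (berezin (Finset.univ ×ˢ {1}) a) := by
  classical
  have : (Finset.univ : Finset (Λ × Fin 2)) = Finset.univ ×ˢ {0} ∪ Finset.univ ×ˢ {1} := by
    ext ⟨i, l⟩
    fin_cases l <;> simp
  rw [this, berezin_union, Module.End.mul_apply, berezinBody_apply]
  rw [Finset.disjoint_left]
  rintro ⟨i, l⟩ h0 h1
  fin_cases l <;> simp at h0 h1

/-- Dimensional reduction. -/
theorem expectation_dimensional_reduction (β : Λ → Λ → ℝ) (h : Λ → ℝ)
    {F : (Option Λ × Option Λ → ℝ) → ℝ} (hF : ContDiff ℝ ∞ F)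
    (hint : SuperIntegrable (n := 2) (m := 2) 1 (weighted β h (observable 2 2 F))) :
    expectation β h (observable 0 1 F) = expectation β h (observable 2 2 F) := by
  have hG := isSusy_prodInvZ.mul (isSusy_weighted β h hF)
  have hL : ∀ g, (∀ i, g ≠ (i, (1 : Fin 2))) → ∀ k ∈ (Finset.univ : Finset Λ) ×ˢ {(1 : Fin 2)},
      g ≠ k := by
    intro g hg k hk e
    exact hg k.1 (e.trans (Prod.ext rfl (by simpa using (Finset.mem_product.1 hk).2)))
  have hne : ∀ i j : Λ, ((i, 0) : Λ × Fin 2) ≠ (j, 1) := fun i j e => by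
    simpa using congrArg Prod.snd e
  -- Localization is applied to the form left after integrating out the second pair; this
  -- integration commutes with the first-pair generators and with all fermionic derivatives, hence
  -- with `Q`.
  have hloc := integral_berezinBody_eq
    (contDiff_linear (berezin ((Finset.univ : Finset Λ) ×ˢ {(1 : Fin 2)})) hG.1)
    (fun φ => by
      rw [susy_linear _ (ContDiff.diffAt hG.1), hG.3, map_zero]
      · intro i x
        exact berezin_ι_mul _ _ (fun k hk => by simp [hL _ (hne i) k hk]) _
      · intro i x
        exact berezin_ι_mul _ _ (fun k hk => by simp [hL _ (hne i) k hk]) _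
      · intro g x
        exact berezin_fermDeriv_comm _ _ _)
    (fun c => hint c)
  rw [expectation, expectation, superIntegral_zero, superIntegral]
  simp only [berezin_univ_eq]
  rw [hloc, ← reduce_prodInvZ, ← reduce_weighted, ← map_mul, body_berezin_reduce]
  -- The normalisation `(2π)^(-2/2)` per site cancels the `2π` per site from localization.
  rw [← mul_assoc, Finset.prod_const, Finset.card_univ, ← mul_pow, Nat.cast_ofNat,
    div_self two_ne_zero, Real.rpow_one, inv_mul_cancel₀ (by positivity), one_pow, one_mul]

end Reduction

end

end SuperHyperbolic

theorem mainTheorem5 {Λ : Type*} [Fintype Λ]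
    (β : Λ → Λ → ℝ) (hβ_symm : ∀ i j, β i j = β j i) (hβ : ∀ i j, 0 ≤ β i j)
    (h : Λ → ℝ) (hh : ∀ i, 0 ≤ h i)
    (F : (Option Λ × Option Λ → ℝ) → ℝ) (hF : ContDiff ℝ ∞ F)
    (hint : SuperHyperbolic.SuperIntegrable (n := 2) (m := 2) 1
      (SuperHyperbolic.weighted β h (SuperHyperbolic.observable 2 2 F))) :
    SuperHyperbolic.expectation β h (SuperHyperbolic.observable 0 1 F) =
      SuperHyperbolic.expectation β h (SuperHyperbolic.observable 2 2 F) := by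
  exact SuperHyperbolic.expectation_dimensional_reduction β h hF hint
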